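/- **Conventions.** For a simplicial set $X$, $C_n(X)$ is the free abelian group on the non-degenerate $n$-simplices, and $C_*(X)$ is the normalized chain complex (alternating sum of faces, degenerate faces set to $0$); a simplicial map $\phi$ induces $\phi_*$ on it. A *discrete vector field* $V$ on a chain complex $(C_*,d)$ of free abelian groups with distinguished bases of cells is a set of pairs $(\sigma,\tau)$, $\sigma$ an $n$-cell and $\tau$ an $(n+1)$-cell, such that $\sigma$ has coefficient $\pm1$ in $d\tau$ and every cell appears in at most one pair and in only one role; the cells are thus divided into source, target and critical (unused) cells. It is *admissible* if the lengths of the $V$-paths (sequences of vectors $(\sigma_k,\tau_k)$ where $\sigma_{k+1}\ne\sigma_k$ has non-zero coefficient in $d\tau_k$) starting from a given cell are bounded. Write $t,s,c$ for the target, source and critical components of chains, $d_{ab}$ for the component of $d$ from $b$ to $a$. The *W-reduction* of an admissible $V$ is the reduction $(f,g,h):(C_*,d)\Rightarrow (C^c_*,d')$ onto the free groups on the critical cells given by $$d'=d_{cc}-d_{ct}d_{st}^{-1}d_{sc},\quad f=\pi_c-d_{ct}d_{st}^{-1}\pi_s,\quad g=\iota_c-\iota_t d_{st}^{-1}d_{sc},\quad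 h=\iota_t d_{st}^{-1}\pi_s ,$$ where *reduction* means that $f,g$ are chain maps and $fg=1$, $gf+dh+hd=1$, $fh=0$, $hg=0$, $hh=0$. A *morphism* from a reduction $(f,g,h):(A,d)\Rightarrow(B,d)$ to a reduction $(f',g',h'):(A',d)\Rightarrow(B',d)$ is a pair of chain maps $\Phi:A\to A'$, $\Psi:B\to B'$ with $\Psi f=f'\Phi$, $\Phi g=g'\Psi$, $\Phi h=h'\Phi$. **Eilenberg-Zilber vector field.** Every non-degenerate $n$-simplex of $X\times Y$ is uniquely $(\alpha^*\sigma,\beta^*\tau)$ with $\sigma\in X_p,\tau\in Y_q$ non-degenerate and $\alpha,\beta$ monotone surjections; it is coded by $(\sigma,\tau)$ and the strictly increasing path $\pi=(\alpha,\beta)$ in the lattice $[0..p]\times[0..q]$, whose steps are horizontal $(1,0)$, vertical $(0,1)$ or diagonal $(1,1)$. Call *event* a diagonal step, or a vertical step immediately followed by a horizontal one (a bend). The vectors of $V_{X\times Y}$ are the pairs of simplices $(\rho,\rho')$ with the same $(\sigma,\tau)$ such that the last event of the path of $\rho'$ is a bend and the path of $\rho$ is obtained from that of $\rho'$ by removing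 the middle vertex of this bend. **Theorem.** (1) For all simplicial sets $X,Y$, $V_{X\times Y}$ is an admissible discrete vector field on $C_*(X\times Y)$; sending $\sigma\otimes\tau$ ($\sigma\in X_p$, $\tau\in Y_q$ non-degenerate) to the simplex of path $(0,0),(1,0),\dots,(p,0),(p,1),\dots,(p,q)$ over $(\sigma,\tau)$ is an isomorphism of graded groups from $C_*(X)\otimes C_*(Y)$ to the critical chains; and the associated W-reduction, transported along this isomorphism, is a reduction $(f,g,h):C_*(X\times Y)\Rightarrow C_*(X)\otimes C_*(Y)$ (the *Eilenberg-Zilber reduction*), the graded group $C_*(X)\otimes C_*(Y)$ carrying the differential transported from the critical complex. (2) For all simplicial maps $\phi:X\to X'$ and $\psi:Y\to Y'$, the pair $\big((\phi\times\psi)_*,\ \phi_*\otimes\psi_*\big)$ is a morphism from the Eilenberg-Zilber reduction of $X\times Y$ to that of $X'\times Y'$. Moreover $\phi\times\psi$ is compatible with the vector fields: if $(\rho,\rho')\in V_{X\times Y}$ and the image of $\rho'$ is non-degenerate, then the image of $\rho$ is non-degenerate and the pair of images is in $V_{X'\times Y'}$; and the image of a critical simplex is critical if it is non-degenerate. (3)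 The induced morphism is natural: identities induce identities, and the morphism induced by $(\phi'\phi,\psi'\psi)$ is the composition of the morphisms induced by $(\phi,\psi)$ and $(\phi',\psi')$. -/

import Mathlib

open CategoryTheory Simplicial MonoidalCategory
open scoped TensorProduct DirectSum

universe u

noncomputable section

namespace EZ

/-! ## Algebraic cellular complexes, discrete vector fields, reductions -/

/-- An algebraic cellular complex (nonnegatively graded): the group of `n`-chains is the free
abelian group on the `n`-cells. -/
structure CellComplex where
  cells : ℕ → Type u
  d : ∀ n, (cells (n + 1) →₀ ℤ) →ₗ[ℤ] (cells n →₀ ℤ)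
  d_comp_d : ∀ n, d n ∘ₗ d (n + 1) = 0

namespace CellComplex

/-- The group of `n`-chains. -/
abbrev Chains (C : CellComplex.{u}) (n : ℕ) : Type u := C.cells n →₀ ℤ

/-- The incidence number: the coefficient of `σ` in `d τ`. -/
def incidence (C : CellComplex.{u}) {n : ℕ} (σ : C.cells n) (τ : C.cells (n + 1)) : ℤ :=
  C.d n (Finsupp.single τ 1) σ

/-- A collection of pairs (`n`-cell, `(n+1)`-cell). -/
abbrev Field (C : CellComplex.{u}) : Type u := ∀ n, C.cells n → C.cells (n + 1) → Prop

variable {C : CellComplex.{u}} (V : C.Field)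

/-- `σ` is the source of some vector. -/
def IsSource {n : ℕ} (σ : C.cells n) : Prop := ∃ τ, V n σ τ

/-- `τ` is the target of some vector. -/
def IsTarget {n : ℕ} (c : C.cells n) : Prop :=
  match n, c with
  | 0, _ => False
  | n + 1, τ => ∃ σ, V n σ τ

/-- A cell is critical if it appears in no vector. -/
def IsCritical {n : ℕ} (c : C.cells n) : Prop := ¬ IsSource V c ∧ ¬ IsTarget V c

/-- Discrete vector field: in every vector the source is a regular face of the target, and a cell
appears at most once. -/
structure IsVectorField : Prop where
  regular : ∀ n (σ : C.cells n) (τ : C.cells (n + 1)), V n σ τ → |C.incidence σ τ| = 1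
  target_unique : ∀ n (σ : C.cells n) (τ τ' : C.cells (n + 1)), V n σ τ → V n σ τ' → τ = τ'
  source_unique : ∀ n (σ σ' : C.cells n) (τ : C.cells (n + 1)), V n σ τ → V n σ' τ → σ = σ'
  disjoint : ∀ n (c : C.cells n), ¬ (IsSource V c ∧ IsTarget V c)

/-- `V`-paths: sequences of vectors such that each source is a face of the preceding target,
different from the preceding source. -/
def IsPath {n : ℕ} (l : List (C.cells n × C.cells (n + 1))) : Prop :=
  (∀ v ∈ l, V n v.1 v.2) ∧ l.IsChain (fun v w => C.incidence w.1 v.2 ≠ 0 ∧ w.1 ≠ v.1)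

/-- Admissibility: the lengths of the `V`-paths starting from a given cell are bounded. -/
def IsAdmissible : Prop :=
  ∀ n, ∃ bound : C.cells n → ℕ, ∀ (v : C.cells n × C.cells (n + 1)) (l : List _),
    IsPath V (v :: l) → (v :: l).length ≤ bound v.1

end CellComplex

/-- The inverse of a bijective linear map (and `0` for other linear maps). -/
def linInv {M N : Type*} [AddCommMonoid M] [Module ℤ M] [AddCommMonoid N] [Module ℤ N]
    (f : M →ₗ[ℤ] N) : N →ₗ[ℤ] M :=
  open scoped Classical in
  if h : Function.Bijective f then (LinearEquiv.ofBijective f h).symm.toLinearMap else 0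

/-- Inclusion of the chains supported by the cells satisfying `P`. -/
def incl {A : Type u} (P : A → Prop) : ({a // P a} →₀ ℤ) →ₗ[ℤ] (A →₀ ℤ) :=
  Finsupp.lmapDomain ℤ ℤ Subtype.val

/-- Projection onto the chains supported by the cells satisfying `P`. -/
def proj {A : Type u} (P : A → Prop) : (A →₀ ℤ) →ₗ[ℤ] ({a // P a} →₀ ℤ) :=
  Finsupp.lsubtypeDomain {a | P a}

namespace CellComplex

variable {C : CellComplex.{u}} (V : C.Field)

/-- The chains generated by the critical cells. -/
abbrev CritChains (n : ℕ) : Type u := {c : C.cells n // IsCritical V c} →₀ ℤ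

/-- A block of the differential. -/
def block {n : ℕ} (P : C.cells (n + 1) → Prop) (Q : C.cells n → Prop) :
    ({c // P c} →₀ ℤ) →ₗ[ℤ] ({c // Q c} →₀ ℤ) :=
  proj Q ∘ₗ C.d n ∘ₗ incl P

/-- The component of the differential from the target cells to the source cells. -/
def dTargetSource (n : ℕ) :
    ({c : C.cells (n + 1) // IsTarget V c} →₀ ℤ) →ₗ[ℤ] ({c : C.cells n // IsSource V c} →₀ ℤ) :=
  block (IsTarget V) (IsSource V)

/-- The homotopy of the W-reduction: the inverse of `dTargetSource` on the source cells,
zero on the target and critical cells. -/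
def wH (n : ℕ) : C.Chains n →ₗ[ℤ] C.Chains (n + 1) :=
  incl (IsTarget V) ∘ₗ linInv (dTargetSource V n) ∘ₗ proj (IsSource V)

/-- The projection of the W-reduction onto the critical chains. -/
def wF (n : ℕ) : C.Chains n →ₗ[ℤ] CritChains V n :=
  proj (IsCritical V) -
    block (IsTarget V) (IsCritical V) ∘ₗ linInv (dTargetSource V n) ∘ₗ proj (IsSource V)

/-- The injection of the W-reduction. -/
def wG (n : ℕ) : CritChains V n →ₗ[ℤ] C.Chains n :=
  match n with
  | 0 => incl (IsCritical V)
  | n + 1 => incl (IsCritical V) -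
      incl (IsTarget V) ∘ₗ linInv (dTargetSource V n) ∘ₗ block (IsCritical V) (IsSource V)

/-- The differential of the critical complex. -/
def wD (n : ℕ) : CritChains V (n + 1) →ₗ[ℤ] CritChains V n :=
  block (IsCritical V) (IsCritical V) -
    block (IsTarget V) (IsCritical V) ∘ₗ linInv (dTargetSource V n) ∘ₗ
      block (IsCritical V) (IsSource V)

end CellComplex

section Reductions

variable {A B A' B' : ℕ → Type*}
  [∀ n, AddCommMonoid (A n)] [∀ n, Module ℤ (A n)]
  [∀ n, AddCommMonoid (B n)] [∀ n, Module ℤ (B n)]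
  [∀ n, AddCommMonoid (A' n)] [∀ n, Module ℤ (A' n)]
  [∀ n, AddCommMonoid (B' n)] [∀ n, Module ℤ (B' n)]

/-- `(f, g, h)` is a reduction of the chain complex `(A, dA)` onto the chain complex `(B, dB)`. -/
structure IsReduction (dA : ∀ n, A (n + 1) →ₗ[ℤ] A n) (dB : ∀ n, B (n + 1) →ₗ[ℤ] B n)
    (f : ∀ n, A n →ₗ[ℤ] B n) (g : ∀ n, B n →ₗ[ℤ] A n) (h : ∀ n, A n →ₗ[ℤ] A (n + 1)) :
    Prop where
  dA_dA : ∀ n, dA n ∘ₗ dA (n + 1) = 0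
  dB_dB : ∀ n, dB n ∘ₗ dB (n + 1) = 0
  f_comm : ∀ n, f n ∘ₗ dA n = dB n ∘ₗ f (n + 1)
  g_comm : ∀ n, g n ∘ₗ dB n = dA n ∘ₗ g (n + 1)
  f_g : ∀ n, f n ∘ₗ g n = LinearMap.id
  homotopy_zero : g 0 ∘ₗ f 0 + dA 0 ∘ₗ h 0 = LinearMap.id
  homotopy_succ : ∀ n, g (n + 1) ∘ₗ f (n + 1) + dA (n + 1) ∘ₗ h (n + 1) + h n ∘ₗ dA n =
    LinearMap.id
  f_h : ∀ n, f (n + 1) ∘ₗ h n = 0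
  h_g : ∀ n, h n ∘ₗ g n = 0
  h_h : ∀ n, h (n + 1) ∘ₗ h n = 0

/-- `(Φ, Ψ)` is a morphism from the reduction `(f, g, h) : (A, dA) ⇒ (B, dB)` to the reduction
`(f', g', h') : (A', dA') ⇒ (B', dB')`: two chain maps commuting with the three components. -/
structure IsReductionMorphism
    (dA : ∀ n, A (n + 1) →ₗ[ℤ] A n) (dB : ∀ n, B (n + 1) →ₗ[ℤ] B n)
    (f : ∀ n, A n →ₗ[ℤ] B n) (g : ∀ n, B n →ₗ[ℤ] A n) (h : ∀ n, A n →ₗ[ℤ] A (n + 1))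
    (dA' : ∀ n, A' (n + 1) →ₗ[ℤ] A' n) (dB' : ∀ n, B' (n + 1) →ₗ[ℤ] B' n)
    (f' : ∀ n, A' n →ₗ[ℤ] B' n) (g' : ∀ n, B' n →ₗ[ℤ] A' n) (h' : ∀ n, A' n →ₗ[ℤ] A' (n + 1))
    (Φ : ∀ n, A n →ₗ[ℤ] A' n) (Ψ : ∀ n, B n →ₗ[ℤ] B' n) : Prop where
  big_comm : ∀ n, Φ n ∘ₗ dA n = dA' n ∘ₗ Φ (n + 1)
  small_comm : ∀ n, Ψ n ∘ₗ dB n = dB' n ∘ₗ Ψ (n + 1)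
  f_comm : ∀ n, Ψ n ∘ₗ f n = f' n ∘ₗ Φ n
  g_comm : ∀ n, Φ n ∘ₗ g n = g' n ∘ₗ Ψ n
  h_comm : ∀ n, Φ (n + 1) ∘ₗ h n = h' n ∘ₗ Φ n

end Reductions

/-! ## Normalized chains of simplicial sets -/

/-- The normalized `n`-chains of a simplicial set. -/
abbrev NChains (X : SSet.{u}) (n : ℕ) : Type u := X.nonDegenerate n →₀ ℤ

/-- The normalized chain of a simplex: the corresponding generator, or zero if the simplex is
degenerate. -/
def cell (X : SSet.{u}) {n : ℕ} (x : X _⦋n⦌) : NChains X n :=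
  open scoped Classical in
  if hx : x ∈ X.nonDegenerate n then Finsupp.single ⟨x, hx⟩ 1 else 0

/-- The differential of the normalized chain complex: the alternating sum of the faces, where
the degenerate faces are cancelled. -/
def normD (X : SSet.{u}) (n : ℕ) : NChains X (n + 1) →ₗ[ℤ] NChains X n :=
  Finsupp.linearCombination ℤ fun x => ∑ i : Fin (n + 2), (-1 : ℤ) ^ (i : ℕ) • cell X (X.δ i x.1)

lemma cell_of_degenerate (X : SSet.{u}) {n : ℕ} (x : X _⦋n⦌) (hx : x ∈ X.degenerate n) :
    cell X x = 0 := by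
  rw [cell, dif_neg]
  exact fun h => h hx

lemma normD_cell (X : SSet.{u}) (n : ℕ) (x : X _⦋n + 1⦌) :
    normD X n (cell X x) = ∑ i : Fin (n + 2), (-1 : ℤ) ^ (i : ℕ) • cell X (X.δ i x) := by
  by_cases hx : x ∈ X.nonDegenerate (n + 1)
  · simp [cell, hx, normD]
  · have hx' : x ∈ X.degenerate (n + 1) := by
      rwa [SSet.mem_degenerate_iff_notMem_nonDegenerate]
    rw [cell_of_degenerate X x hx', map_zero]
    rw [SSet.degenerate_eq_iUnion_range_σ] at hx'
    simp only [Set.mem_iUnion, Set.mem_range] at hx'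
    obtain ⟨j, y, rfl⟩ := hx'
    symm
    have key : ∀ i : Fin (n + 2), i ≠ j.castSucc → i ≠ j.succ →
        cell X (X.δ i (X.σ j y)) = 0 := by
      intro i h1 h2
      apply cell_of_degenerate
      obtain _ | n := n
      · fin_cases j; fin_cases i <;> simp at h1 h2
      · rcases lt_or_gt_of_ne h1 with h | h
        · obtain ⟨i, rfl⟩ := Fin.eq_castSucc_of_ne_last (x := i) (Fin.ne_last_of_lt h)
          obtain ⟨j, rfl⟩ := Fin.eq_succ_of_ne_zero (i := j) (by
            rintro rfl; simp at h)
          have h' : i ≤ j.castSucc := by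
            simp only [Fin.lt_def, Fin.le_def, Fin.val_castSucc, Fin.val_succ] at h ⊢; omega
          rw [SSet.δ_comp_σ_of_le_apply h']
          exact SSet.σ_mem_degenerate _ _ _
        · have h3 : j.succ < i := by
            simp only [Fin.lt_def, Fin.val_castSucc, Fin.val_succ, ne_eq, Fin.ext_iff] at h h2 ⊢
            omega
          obtain ⟨i, rfl⟩ := Fin.eq_succ_of_ne_zero (i := i) (by
            rintro rfl; simp at h3)
          obtain ⟨j, rfl⟩ := Fin.eq_castSucc_of_ne_last (x := j) (by
            rintro rfl
            simp only [Fin.lt_def, Fin.val_succ, Fin.val_last] at h3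
            omega)
          have h' : j.castSucc < i := by
            simp only [Fin.lt_def, Fin.val_castSucc, Fin.val_succ] at h3 ⊢; omega
          rw [SSet.δ_comp_σ_of_gt_apply h']
          exact SSet.σ_mem_degenerate _ _ _
    rw [← Finset.sum_subset (Finset.subset_univ {j.castSucc, j.succ})]
    · rw [Finset.sum_pair (by simp [Fin.ext_iff]), SSet.δ_comp_σ_self_apply,
        SSet.δ_comp_σ_succ_apply]
      simp [pow_succ]
    · intro i _ hi
      simp only [Finset.mem_insert, Finset.mem_singleton, not_or] at hi
      rw [key i hi.1 hi.2, smul_zero]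

lemma normD_normD (X : SSet.{u}) (n : ℕ) : normD X n ∘ₗ normD X (n + 1) = 0 := by
  refine Finsupp.lhom_ext' fun x => LinearMap.ext_ring ?_
  have hx : normD X (n + 1) (Finsupp.single x 1) = ∑ i : Fin (n + 3),
      (-1 : ℤ) ^ (i : ℕ) • cell X (X.δ i x.1) := by simp [normD]
  simp only [LinearMap.comp_apply, Finsupp.lsingle_apply, hx, map_sum, map_zsmul, normD_cell,
    Finset.smul_sum, smul_smul, LinearMap.zero_apply]
  rw [Finset.sum_comm, ← Finset.sum_product']
  let P := Fin (n + 2) × Fin (n + 3)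
  let S : Finset P := Finset.univ.filter fun ij => (ij.2 : ℕ) ≤ (ij.1 : ℕ)
  rw [Finset.univ_product_univ, ← Finset.sum_add_sum_compl S, ← eq_neg_iff_add_eq_zero,
    ← Finset.sum_neg_distrib]
  let φ : ∀ ij : P, ij ∈ S → P := fun ij hij =>
    (Fin.castLT ij.2 (lt_of_le_of_lt (Finset.mem_filter.mp hij).right (Fin.is_lt ij.1)), ij.1.succ)
  apply Finset.sum_bij φ
  · intro ij hij
    simp_rw [S, φ, Finset.compl_filter, Finset.mem_filter_univ, Fin.val_succ,
      Fin.val_castLT] at hij ⊢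
    lia
  · rintro ⟨i, j⟩ hij ⟨i', j'⟩ hij' h
    rw [Prod.mk_inj]
    exact ⟨by simpa [φ] using! congr_arg Prod.snd h,
      by simpa [φ, Fin.castSucc_castLT] using! congr_arg Fin.castSucc (congr_arg Prod.fst h)⟩
  · rintro ⟨i', j'⟩ hij'
    simp_rw [S, Finset.compl_filter, Finset.mem_filter_univ, not_le] at hij'
    refine ⟨(j'.pred <| ?_, Fin.castSucc i'), ?_, ?_⟩
    · rintro rfl
      simp only [Fin.val_zero, not_lt_zero] at hij'
    · simpa [S] using! Nat.le_sub_one_of_lt hij'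
    · simp only [φ, Fin.castLT_castSucc, Fin.succ_pred]
  · rintro ⟨i, j⟩ hij
    have hij' : j ≤ i.castSucc := by simpa [S, Fin.le_def] using hij
    have e : X.δ i (X.δ j x.1) =
        X.δ (j.castLT (lt_of_le_of_lt (Finset.mem_filter.mp hij).right i.is_lt))
          (X.δ i.succ x.1) :=
      ConcreteCategory.congr_hom (SimplicialObject.δ_comp_δ'' (X := X) hij').symm x.1
    simp only [φ, Fin.val_succ, Fin.val_castLT, ← neg_smul]
    rw [← e]
    congr 1
    ring

/-- The normalized chain complex of a simplicial set. -/
abbrev normalized (X : SSet.{u}) : CellComplex.{u} where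
  cells n := X.nonDegenerate n
  d := normD X
  d_comp_d := normD_normD X

/-- The map induced on the normalized chains by a simplicial map. -/
def normMap {X X' : SSet.{u}} (φ : X ⟶ X') (n : ℕ) : NChains X n →ₗ[ℤ] NChains X' n :=
  Finsupp.linearCombination ℤ fun x => cell X' (φ.app _ x.1)

/-! ## s-paths -/

/-- A monotone path with `n` steps in the lattice `[0..p] × [0..q]`. -/
abbrev LPath (n p q : ℕ) : Type := Fin (n + 1) →o Fin (p + 1) × Fin (q + 1)

namespace LPath

variable {n p q : ℕ}

/-- Interior s-paths: strictly increasing paths whose two projections run all the vertices. -/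
def IsInterior (π : LPath n p q) : Prop :=
  StrictMono π ∧ Function.Surjective (fun i => (π i).1) ∧ Function.Surjective (fun i => (π i).2)

/-- The `i`-th step is vertical. -/
def Vert (π : LPath n p q) (i : Fin n) : Prop :=
  (π i.castSucc).1 = (π i.succ).1 ∧ (π i.castSucc).2 < (π i.succ).2

/-- The `i`-th step is horizontal. -/
def Horiz (π : LPath n p q) (i : Fin n) : Prop :=
  (π i.castSucc).1 < (π i.succ).1 ∧ (π i.castSucc).2 = (π i.succ).2

/-- The `i`-th step is diagonal. -/
def Diag (π : LPath n p q) (i : Fin n) : Prop :=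
  (π i.castSucc).1 < (π i.succ).1 ∧ (π i.castSucc).2 < (π i.succ).2

/-- The `i`-th step is vertical and the next one is horizontal: read backward from `(p, q)`,
the path has a `+90°` bend at its vertex `i + 1`. -/
def Bend (π : LPath n p q) (i : Fin n) : Prop :=
  π.Vert i ∧ ∃ j : Fin n, (j : ℕ) = i + 1 ∧ π.Horiz j

/-- No event (diagonal step or bend) occurs after the `i`-th step; that is, an event at `i` is the
first one which is met when the path is run backward. -/
def NoEventAfter (π : LPath n p q) (i : Fin n) : Prop :=
  ∀ j : Fin n, i < j → ¬ π.Diag j ∧ ¬ π.Bend j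

/-- The pairing of s-paths: the first event of `π'` (run backward) is a bend, and `π` is the face
of `π'` where the vertex of this bend is skipped, so that the first event of `π` is the
corresponding diagonal step. -/
def Paired (π : LPath n p q) (π' : LPath (n + 1) p q) : Prop :=
  ∃ i : Fin (n + 1), π'.Bend i ∧ π'.NoEventAfter i ∧ ∀ j, π j = π' (i.succ.succAbove j)

/-- The last simplex: `((0,0), (1,0), …, (p,0), (p,1), …, (p,q))`. -/
def last (h : p + q = n) : LPath n p q where
  toFun i := (⟨min i p, by omega⟩, ⟨i - p, by omega⟩)
  monotone' i j hij := by
    have : (i : ℕ) ≤ j := hij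
    constructor <;> simp only [Fin.mk_le_mk] <;> omega

end LPath

/-! ## The Eilenberg-Zilber vector field and the Eilenberg-Zilber reduction -/

variable {X Y X' Y' X'' Y'' : SSet.{u}}

/-- The simplex of `X × Y` given by the path `π` in the prism `σ × τ`: the pair of
the degeneracies of `σ` and `τ` along the two projections of `π`. -/
def prismSimplex {n p q : ℕ} (σ : X _⦋p⦌) (τ : Y _⦋q⦌) (π : LPath n p q) : (X ⊗ Y) _⦋n⦌ :=
  (X.map (SimplexCategory.mkHom (OrderHom.fst.comp π)).op σ,
    Y.map (SimplexCategory.mkHom (OrderHom.snd.comp π)).op τ)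

/-- The Eilenberg-Zilber vector field of `X × Y`: the vectors are the pairs of simplices of a
common prism `σ × τ`, with `σ` and `τ` non-degenerate, coded by two paired interior s-paths. -/
def ezField (X Y : SSet.{u}) : (normalized (X ⊗ Y)).Field := fun n ρ ρ' =>
  ∃ (p q : ℕ) (σ : X.nonDegenerate p) (τ : Y.nonDegenerate q)
    (π : LPath n p q) (π' : LPath (n + 1) p q),
    π.IsInterior ∧ π'.IsInterior ∧ π.Paired π' ∧
      ρ.1 = prismSimplex σ.1 τ.1 π ∧ ρ'.1 = prismSimplex σ.1 τ.1 π'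

/-- The underlying graded module of the tensor product of the normalized chain complexes. -/
abbrev Tens (X Y : SSet.{u}) (n : ℕ) : Type u :=
  ⨁ pq : {pq : ℕ × ℕ // pq.1 + pq.2 = n}, NChains X pq.1.1 ⊗[ℤ] NChains Y pq.1.2

/-- The map `φ ⊗ ψ` between the tensor products. -/
def tensMap (φ : X ⟶ X') (ψ : Y ⟶ Y') (n : ℕ) : Tens X Y n →ₗ[ℤ] Tens X' Y' n :=
  DirectSum.lmap fun pq : {pq : ℕ × ℕ // pq.1 + pq.2 = n} =>
    TensorProduct.map (normMap φ pq.1.1) (normMap ψ pq.1.2)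

/-- The identification of the tensor product with the critical chains of the Eilenberg-Zilber
vector field: `σ ⊗ τ` is sent to the last simplex of the prism `σ × τ`. -/
def critOfTens (X Y : SSet.{u}) (n : ℕ) :
    Tens X Y n →ₗ[ℤ] CellComplex.CritChains (ezField X Y) n :=
  DirectSum.toModule ℤ {pq : ℕ × ℕ // pq.1 + pq.2 = n} _ fun pq =>
    Finsupp.linearCombination ℤ (fun στ : X.nonDegenerate pq.1.1 × Y.nonDegenerate pq.1.2 =>
      proj (CellComplex.IsCritical (ezField X Y))
        (cell (X ⊗ Y) (prismSimplex στ.1.1 στ.2.1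
          (LPath.last pq.2)))) ∘ₗ
      (finsuppTensorFinsupp' ℤ (X.nonDegenerate pq.1.1) (Y.nonDegenerate pq.1.2)).toLinearMap

/-- The projection of the Eilenberg-Zilber reduction. -/
def ezF (X Y : SSet.{u}) (n : ℕ) : NChains (X ⊗ Y) n →ₗ[ℤ] Tens X Y n :=
  linInv (critOfTens X Y n) ∘ₗ CellComplex.wF (ezField X Y) n

/-- The injection of the Eilenberg-Zilber reduction. -/
def ezG (X Y : SSet.{u}) (n : ℕ) : Tens X Y n →ₗ[ℤ] NChains (X ⊗ Y) n :=
  CellComplex.wG (ezField X Y) n ∘ₗ critOfTens X Y n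

/-- The homotopy of the Eilenberg-Zilber reduction. -/
def ezH (X Y : SSet.{u}) (n : ℕ) : NChains (X ⊗ Y) n →ₗ[ℤ] NChains (X ⊗ Y) (n + 1) :=
  CellComplex.wH (ezField X Y) n

/-- The differential which the Eilenberg-Zilber reduction puts on the tensor product. -/
def ezD (X Y : SSet.{u}) (n : ℕ) : Tens X Y (n + 1) →ₗ[ℤ] Tens X Y n :=
  linInv (critOfTens X Y n) ∘ₗ CellComplex.wD (ezField X Y) n ∘ₗ critOfTens X Y (n + 1)

/-- Compatibility of a product map with the Eilenberg-Zilber vector fields: a vector whose target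
has a non-degenerate image is sent to a vector, and a critical simplex with a non-degenerate image
is sent to a critical simplex. -/
structure IsFieldCompatible (φ : X ⟶ X') (ψ : Y ⟶ Y') : Prop where
  vector : ∀ (n : ℕ) (ρ : (X ⊗ Y).nonDegenerate n) (ρ' : (X ⊗ Y).nonDegenerate (n + 1)),
    ezField X Y n ρ ρ' →
      ∀ hρ' : (φ ⊗ₘ ψ).app _ ρ'.1 ∈ (X' ⊗ Y').nonDegenerate (n + 1),
        ∃ hρ : (φ ⊗ₘ ψ).app _ ρ.1 ∈ (X' ⊗ Y').nonDegenerate n,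
          ezField X' Y' n ⟨(φ ⊗ₘ ψ).app _ ρ.1, hρ⟩ ⟨(φ ⊗ₘ ψ).app _ ρ'.1, hρ'⟩
  critical : ∀ (n : ℕ) (ρ : (X ⊗ Y).nonDegenerate n),
    CellComplex.IsCritical (ezField X Y) ρ →
      ∀ hρ : (φ ⊗ₘ ψ).app _ ρ.1 ∈ (X' ⊗ Y').nonDegenerate n,
        CellComplex.IsCritical (ezField X' Y') (⟨(φ ⊗ₘ ψ).app _ ρ.1, hρ⟩ :
          (X' ⊗ Y').nonDegenerate n)

end EZ

end

/-! The algebra rests on a rank: a natural number attached to cells that drops along every `V`-path.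
It bounds the paths and makes the block $d_{st}$ triangular with diagonal entries $\pm1$, hence
invertible (`IsRank.injective`, `IsRank.surjective`). From $hh=0$ and $hdh=h$, the operator
$P=1-dh-hd$ is a projector commuting with $d$. It kills target chains and has no source component,
so $P\iota_c\pi_cP=P$. Since $f=\pi_cP$, $g=P\iota_c$ and $d'=\pi_c dP\iota_c$, every identity of a
reduction is formal.

A chain map $\Phi$ sending target chains to target chains and critical chains to critical chains
commutes with $h$, whatever it does to sources (`Preserves.map_wH`): $\Phi hx$ is a target chain, so
it equals $h'd'\Phi hx=h'\Phi dhx$; and $dhx$ has the same source part as $x$, the only part that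
$h'\Phi$ sees. Commutation with $P$, $f$, $g$ and $d'$ follows.

For the Eilenberg-Zilber field, a path is a source, a target or critical according as its last event
is a diagonal, a bend or absent. Inside a prism, any face of a target other than its paired source
that is again a source omits a vertex with larger $x-y$ than the bend vertex (`IsWalk.descent`), so
it has smaller weight. The remaining source faces lie in smaller prisms. The lexicographic pair
(dimension of the prism, weight) is therefore a rank.

For functoriality, the image of a prism is governed by monotone surjections $s,t$ acting on the two
coordinates. If the image of a path is still injective, a non-diagonal step keeps its type and no
diagonal step is created. Hence last bends and quiet paths persist, which is all that `Preserves`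
asks. The last path exists exactly once over each pair $(\sigma,\tau)$, which identifies critical
cells with the basis of the tensor product. -/

namespace EZ

/-! ### Linear inverses, and chains supported by a set of cells. -/

section LinInv

variable {M N : Type*} [AddCommMonoid M] [Module ℤ M] [AddCommMonoid N] [Module ℤ N]

lemma linInv_apply_apply {f : M →ₗ[ℤ] N} (hf : Function.Bijective f) (x : M) :
    linInv f (f x) = x := by
  rw [linInv, dif_pos hf]
  exact (LinearEquiv.ofBijective f hf).symm_apply_apply x

lemma apply_linInv_apply {f : M →ₗ[ℤ] N} (hf : Function.Bijective f) (y : N) :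
    f (linInv f y) = y := by
  rw [linInv, dif_pos hf]
  exact (LinearEquiv.ofBijective f hf).apply_symm_apply y

end LinInv

section InclProj

variable {A : Type u} {P Q : A → Prop}

@[simp]
lemma incl_single (a : {a // P a}) (r : ℤ) :
    incl P (Finsupp.single a r) = Finsupp.single a.1 r := by
  simp [incl, Finsupp.mapDomain_single]

@[simp]
lemma proj_apply (x : A →₀ ℤ) (a : {a // P a}) : proj P x a = x a.1 := rfl

lemma proj_single_of_pos {a : A} (h : P a) (r : ℤ) :
    proj P (Finsupp.single a r) = Finsupp.single ⟨a, h⟩ r := by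
  classical
  ext b
  simp [Finsupp.single_apply, Subtype.ext_iff]

lemma proj_single_of_neg {a : A} (h : ¬ P a) (r : ℤ) : proj P (Finsupp.single a r) = 0 := by
  classical
  ext b
  have : a ≠ b.1 := by rintro rfl; exact h b.2
  simp [this]

@[simp]
lemma proj_incl (x : {a // P a} →₀ ℤ) : proj P (incl P x) = x := by
  induction x using Finsupp.induction_linear with
  | zero => simp
  | add x y hx hy => simp [hx, hy]
  | single a r => simp [proj_single_of_pos a.2]

lemma proj_incl_of_disjoint (h : ∀ a, ¬ (P a ∧ Q a)) (x : {a // P a} →₀ ℤ) :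
    proj Q (incl P x) = 0 := by
  induction x using Finsupp.induction_linear with
  | zero => simp
  | add x y hx hy => simp [hx, hy]
  | single a r => simp [proj_single_of_neg fun hQ => h a.1 ⟨a.2, hQ⟩]

end InclProj

/-! ### Rank functions and invertibility of the target-source block. -/

namespace CellComplex

variable {C : CellComplex.{u}} {V : C.Field}

/-- `μ` decreases strictly along the `V`-paths. -/
def IsRank (V : C.Field) (μ : ∀ n, C.cells n → ℕ) : Prop :=
  ∀ n (σ σ' : C.cells n) (τ : C.cells (n + 1)), V n σ τ → IsSource V σ' →
    C.incidence σ' τ ≠ 0 → σ' ≠ σ → μ n σ' < μ n σ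

lemma IsRank.isAdmissible {μ : ∀ n, C.cells n → ℕ} (hμ : IsRank V μ) : IsAdmissible V := by
  intro n
  refine ⟨fun σ => μ n σ + 1, fun v l => ?_⟩
  induction l generalizing v with
  | nil => simp
  | cons w l ih =>
    rintro ⟨h1, h2⟩
    rw [List.isChain_cons_cons] at h2
    have hw := ih w ⟨fun x hx => h1 x (List.mem_cons_of_mem _ hx), h2.2⟩
    have := hμ n v.1 w.1 v.2 (h1 v (by simp)) ⟨w.2, h1 w (by simp)⟩ h2.1.1 h2.1.2
    simp only [List.length_cons] at hw ⊢
    omega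

lemma dTargetSource_apply {n : ℕ} (x : {c : C.cells (n + 1) // IsTarget V c} →₀ ℤ)
    (σ : {c : C.cells n // IsSource V c}) :
    dTargetSource V n x σ = x.sum fun τ r => r * C.incidence σ.1 τ.1 := by
  induction x using Finsupp.induction_linear with
  | zero => simp
  | add x y hx hy =>
    rw [Finsupp.sum_add_index' (by simp) (by intros; ring), ← hx, ← hy, map_add]
    rfl
  | single a r =>
    have : (Finsupp.single a.1 r : C.Chains (n + 1)) = r • Finsupp.single a.1 1 := by simp
    simp [dTargetSource, block, incidence, this, -Finsupp.smul_single]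

/-- In the support of a kernel element, choose the target whose source has maximal rank. No other
target of the support can have that source as a face, so its coefficient, up to sign, survives in
the image. -/
lemma IsRank.injective {μ : ∀ n, C.cells n → ℕ} (hμ : IsRank V μ) (hV : IsVectorField V)
    (n : ℕ) : Function.Injective (dTargetSource V n) := by
  rw [injective_iff_map_eq_zero]
  intro x hx
  by_contra hne
  choose s hs using fun τ : {c : C.cells (n + 1) // IsTarget V c} => τ.2
  obtain ⟨τ, hτ, hmax⟩ := Finset.exists_max_image x.support (fun τ => μ n (s τ))
    (Finsupp.support_nonempty_iff.2 hne)
  have h := DFunLike.congr_fun hx ⟨s τ, τ.1, hs τ⟩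
  rw [dTargetSource_apply, Finsupp.sum, Finset.sum_eq_single τ] at h
  · have h1 := hV.regular n _ _ (hs τ)
    rcases mul_eq_zero.1 h with h0 | h0
    · exact Finsupp.mem_support_iff.1 hτ h0
    · simp only at h0
      rw [h0] at h1
      simp at h1
  · intro τ' hτ' hne'
    by_contra h0
    have h1 : C.incidence (s τ) τ'.1 ≠ 0 := fun h => h0 (by simp [h])
    have h2 : s τ ≠ s τ' := fun h => hne' (Subtype.ext
      (hV.target_unique n (s τ') _ _ (hs τ') (h ▸ hs τ)))
    exact absurd (hμ n (s τ') (s τ) τ'.1 (hs τ') ⟨_, hs τ⟩ h1 h2) (not_lt.2 (hmax τ' hτ'))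
  · intro h0
    exact absurd hτ h0

/-- Induction on the rank: the image of the target paired with `σ` is `±σ` plus sources of smaller
rank, which are already reached. -/
lemma IsRank.surjective {μ : ∀ n, C.cells n → ℕ} (hμ : IsRank V μ) (hV : IsVectorField V)
    (n : ℕ) : Function.Surjective (dTargetSource V n) := by
  rw [← LinearMap.range_eq_top]
  have key : ∀ (m : ℕ) (σ : {c : C.cells n // IsSource V c}), μ n σ.1 = m →
      Finsupp.single σ (1 : ℤ) ∈ LinearMap.range (dTargetSource V n) := by
    intro m
    induction m using Nat.strong_induction_on with
    | _ m ih =>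
    rintro σ rfl
    obtain ⟨τ, hτ⟩ := σ.2
    classical
    set y := dTargetSource V n (Finsupp.single ⟨τ, σ.1, hτ⟩ 1) with hy
    have hy_apply : ∀ σ', y σ' = C.incidence σ'.1 τ := fun σ' => by
      rw [hy, dTargetSource_apply]; simp
    have hreg := hV.regular n _ _ hτ
    have hyσ : y = Finsupp.single σ (y σ) + y.erase σ := (Finsupp.single_add_erase σ y).symm
    have hmem : y.erase σ ∈ LinearMap.range (dTargetSource V n) := by
      rw [← Finsupp.sum_single (y.erase σ)]
      refine Submodule.sum_mem _ fun σ' hσ' => ?_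
      rw [Finsupp.support_erase, Finset.mem_erase] at hσ'
      have h1 : C.incidence σ'.1 τ ≠ 0 := by
        rw [← hy_apply]; exact Finsupp.mem_support_iff.1 hσ'.2
      have h2 := ih _ (hμ n σ.1 σ'.1 τ hτ σ'.2 h1 fun h => hσ'.1 (Subtype.ext h)) σ' rfl
      have := Submodule.smul_mem _ (y.erase σ σ') h2
      simpa using this
    have hmem' : Finsupp.single σ (y σ) ∈ LinearMap.range (dTargetSource V n) := by
      have := Submodule.sub_mem _ (LinearMap.mem_range_self (dTargetSource V n)
        (Finsupp.single ⟨τ, σ.1, hτ⟩ 1)) hmem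
      rwa [← hy, sub_eq_of_eq_add hyσ] at this
    have hsq : y σ * y σ = 1 := by
      rw [← abs_mul_abs_self, hy_apply, hreg, mul_one]
    have := Submodule.smul_mem _ (y σ) hmem'
    simpa [hsq] using this
  rw [eq_top_iff]
  intro x _
  rw [← Finsupp.sum_single x]
  refine Submodule.sum_mem _ fun σ _ => ?_
  have := Submodule.smul_mem _ (x σ) (key _ σ rfl)
  simpa using this

/-- The projector `1 - dh - hd` of the W-reduction. -/
noncomputable def wP (V : C.Field) (n : ℕ) : C.Chains n →ₗ[ℤ] C.Chains n :=
  match n with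
  | 0 => LinearMap.id - C.d 0 ∘ₗ wH V 0
  | n + 1 => LinearMap.id - C.d (n + 1) ∘ₗ wH V (n + 1) - wH V n ∘ₗ C.d n

lemma d_d (n : ℕ) (x : C.Chains (n + 2)) : C.d n (C.d (n + 1) x) = 0 :=
  LinearMap.congr_fun (C.d_comp_d n) x

lemma IsVectorField.partition (hV : IsVectorField V) (n : ℕ) (x : C.Chains n) :
    incl (IsTarget V) (proj (IsTarget V) x) + incl (IsSource V) (proj (IsSource V) x) +
      incl (IsCritical V) (proj (IsCritical V) x) = x := by
  induction x using Finsupp.induction_linear with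
  | zero => simp
  | add x y hx hy =>
    refine Eq.trans ?_ (congrArg₂ (· + ·) hx hy)
    simp only [map_add]
    abel
  | single a r =>
    by_cases hs : IsSource V a
    · have ht : ¬ IsTarget V a := fun h => hV.disjoint n a ⟨hs, h⟩
      have hc : ¬ IsCritical V a := fun h => h.1 hs
      simp [proj_single_of_pos hs, proj_single_of_neg ht, proj_single_of_neg hc]
    · by_cases ht : IsTarget V a
      · have hc : ¬ IsCritical V a := fun h => h.2 ht
        simp [proj_single_of_neg hs, proj_single_of_pos ht, proj_single_of_neg hc]
      · have hc : IsCritical V a := ⟨hs, ht⟩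
        simp [proj_single_of_neg hs, proj_single_of_neg ht, proj_single_of_pos hc]

/-! ### The W-reduction, expressed through the projector `wP`. -/

section Reduction

variable (hV : IsVectorField V) (hB : ∀ n, Function.Bijective (dTargetSource V n))
include hV hB

omit hV in
lemma projS_d_wH (n : ℕ) (x : C.Chains n) :
    proj (IsSource V) (C.d n (wH V n x)) = proj (IsSource V) x :=
  apply_linInv_apply (hB n) _

omit hV in
lemma wH_d_inclT (n : ℕ) (x : {c : C.cells (n + 1) // IsTarget V c} →₀ ℤ) :
    wH V n (C.d n (incl (IsTarget V) x)) = incl (IsTarget V) x :=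
  congrArg (incl (IsTarget V)) (linInv_apply_apply (hB n) x)

omit hB in
lemma wH_inclT (n : ℕ) (x : {c : C.cells n // IsTarget V c} →₀ ℤ) :
    wH V n (incl (IsTarget V) x) = 0 := by
  simp [wH, proj_incl_of_disjoint fun a h => hV.disjoint n a h.symm]

omit hB hV in
lemma wH_inclC (n : ℕ) (x : CritChains V n) : wH V n (incl (IsCritical V) x) = 0 := by
  simp [wH, proj_incl_of_disjoint fun a (h : IsCritical V a ∧ IsSource V a) => h.1.1 h.2]

omit hB hV in
lemma projC_wH (n : ℕ) (x : C.Chains n) : proj (IsCritical V) (wH V n x) = 0 := by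
  simp [wH, proj_incl_of_disjoint fun a (h : IsTarget V a ∧ IsCritical V a) => h.2.2 h.1]

omit hB in
lemma projS_wH (n : ℕ) (x : C.Chains n) : proj (IsSource V) (wH V n x) = 0 := by
  simp [wH, proj_incl_of_disjoint fun a h => hV.disjoint (n + 1) a h.symm]

omit hB in
lemma wH_wH (n : ℕ) (x : C.Chains n) : wH V (n + 1) (wH V n x) = 0 :=
  wH_inclT hV _ _

omit hV in
lemma wH_d_wH (n : ℕ) (x : C.Chains n) : wH V n (C.d n (wH V n x)) = wH V n x :=
  wH_d_inclT hB _ _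

lemma wP_inclT (n : ℕ) (x : {c : C.cells n // IsTarget V c} →₀ ℤ) :
    wP V n (incl (IsTarget V) x) = 0 := by
  cases n with
  | zero =>
    -- No cell of degree 0 is a target.
    have : x = 0 := by ext ⟨c, hc⟩; exact hc.elim
    simp [this]
  | succ n => simp [wP, wH_inclT hV, wH_d_inclT hB]

lemma projS_wP (n : ℕ) (x : C.Chains n) : proj (IsSource V) (wP V n x) = 0 := by
  cases n <;> simp [wP, projS_d_wH hB, projS_wH hV]

omit hV hB in
lemma wP_d (n : ℕ) (x : C.Chains (n + 1)) : wP V n (C.d n x) = C.d n (wP V (n + 1) x) := by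
  cases n <;> simp [wP, d_d]

lemma wP_wH (n : ℕ) (x : C.Chains n) : wP V (n + 1) (wH V n x) = 0 := by
  simp [wP, wH_wH hV, wH_d_wH hB]

lemma wH_wP (n : ℕ) (x : C.Chains n) : wH V n (wP V n x) = 0 := by
  cases n <;> simp [wP, wH_wH hV, wH_d_wH hB]

lemma wP_wP (n : ℕ) (x : C.Chains n) : wP V n (wP V n x) = wP V n x := by
  cases n with
  | zero =>
    have h := wH_wP hV hB 0 x
    nth_rw 1 [wP]
    simp [h]
  | succ n =>
    have h := wH_wP hV hB (n + 1) x
    have h' := wH_wP hV hB n (C.d n x)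
    nth_rw 1 [wP]
    simp [h, ← wP_d, h']

/-- The projector kills target chains and its values have no source part, so only the critical part
of `wP V n x` matters when it is applied again. This lets critical chains be inserted between two
factors in every identity below. -/
lemma wP_incl_proj_wP (n : ℕ) (x : C.Chains n) :
    wP V n (incl (IsCritical V) (proj (IsCritical V) (wP V n x))) = wP V n x := by
  conv_rhs => rw [← wP_wP hV hB, ← hV.partition n (wP V n x)]
  simp [wP_inclT hV hB, projS_wP hV hB]

-- The formula for `f` lacks the term `hd` of the projector because homotopies take values in target
-- chains, which `proj` to critical chains annihilates. Dually, the formulas for `g` and `d'` lack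
-- `dh` because `h` vanishes on critical chains.
omit hB hV in
lemma wF_apply (n : ℕ) (x : C.Chains n) : wF V n x = proj (IsCritical V) (wP V n x) := by
  have : wF V n x = proj (IsCritical V) x - proj (IsCritical V) (C.d n (wH V n x)) := rfl
  cases n <;> simp [this, wP, projC_wH]

omit hB hV in
lemma wG_apply (n : ℕ) (x : CritChains V n) : wG V n x = wP V n (incl (IsCritical V) x) := by
  cases n with
  | zero => simp [wG, wP, wH_inclC]
  | succ n =>
    have : wG V (n + 1) x = incl (IsCritical V) x - wH V n (C.d n (incl (IsCritical V) x)) := rfl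
    simp [this, wP, wH_inclC]

omit hB hV in
lemma wD_apply (n : ℕ) (x : CritChains V (n + 1)) :
    wD V n x = proj (IsCritical V) (C.d n (wP V (n + 1) (incl (IsCritical V) x))) := by
  have : wD V n x = proj (IsCritical V) (C.d n (incl (IsCritical V) x)) -
    proj (IsCritical V) (C.d n (wH V n (C.d n (incl (IsCritical V) x)))) := rfl
  simp [this, wP, wH_inclC]

lemma isReduction_w : IsReduction C.d (wD V) (wF V) (wG V) (wH V) where
  dA_dA := C.d_comp_d
  dB_dB n := by
    refine LinearMap.ext fun x => ?_
    simp only [LinearMap.comp_apply, wD_apply, LinearMap.zero_apply, ← wP_d,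
      wP_incl_proj_wP hV hB, d_d, map_zero]
  f_comm n := by
    refine LinearMap.ext fun x => ?_
    simp only [LinearMap.comp_apply, wD_apply, wF_apply, wP_d, wP_incl_proj_wP hV hB]
  g_comm n := by
    refine LinearMap.ext fun x => ?_
    simp only [LinearMap.comp_apply, wD_apply, wG_apply, ← wP_d, wP_incl_proj_wP hV hB]
  f_g n := by
    refine LinearMap.ext fun x => ?_
    simp only [LinearMap.comp_apply, wF_apply, wG_apply, wP_wP hV hB, LinearMap.id_apply]
    cases n <;> simp [wP, wH_inclC, projC_wH]
  homotopy_zero := by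
    refine LinearMap.ext fun x => ?_
    simp only [LinearMap.comp_apply, wF_apply, wG_apply, LinearMap.add_apply,
      wP_incl_proj_wP hV hB, LinearMap.id_apply]
    simp [wP]
  homotopy_succ n := by
    refine LinearMap.ext fun x => ?_
    simp only [LinearMap.comp_apply, wF_apply, wG_apply, LinearMap.add_apply,
      wP_incl_proj_wP hV hB, LinearMap.id_apply]
    simp only [wP, LinearMap.sub_apply, LinearMap.id_apply, LinearMap.comp_apply]
    abel
  f_h n := by
    refine LinearMap.ext fun x => ?_
    simp [wF_apply, wP_wH hV hB]
  h_g n := by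
    refine LinearMap.ext fun x => ?_
    simp [wG_apply, wH_wP hV hB]
  h_h n := by
    refine LinearMap.ext fun x => ?_
    simp [wH_wH hV]

end Reduction

/-! ### Morphisms of W-reductions. -/

section Morphism

variable {C' : CellComplex.{u}} {V' : C'.Field}

/-- A chain map which sends target cells to chains of target cells and critical cells to chains
of critical cells. -/
structure Preserves (V : C.Field) (V' : C'.Field) (Φ : ∀ n, C.Chains n →ₗ[ℤ] C'.Chains n) :
    Prop where
  comm : ∀ n x, Φ n (C.d n x) = C'.d n (Φ (n + 1) x)
  target : ∀ n x, Φ n (incl (IsTarget V) x) =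
    incl (IsTarget V') (proj (IsTarget V') (Φ n (incl (IsTarget V) x)))
  critical : ∀ n x, Φ n (incl (IsCritical V) x) =
    incl (IsCritical V') (proj (IsCritical V') (Φ n (incl (IsCritical V) x)))

namespace Preserves

variable {Φ : ∀ n, C.Chains n →ₗ[ℤ] C'.Chains n} (hΦ : Preserves V V' Φ)
  (hV : IsVectorField V) (hB : ∀ n, Function.Bijective (dTargetSource V n))
  (hV' : IsVectorField V') (hB' : ∀ n, Function.Bijective (dTargetSource V' n))
include hΦ hV hB hV' hB'

/-- No hypothesis on the images of sources is needed: `wH V' n ∘ Φ n` sees only the source part of a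
chain, `x` and `C.d n (wH V n x)` have the same one, and `wH V'` inverts the differential on the
target chain `Φ (n + 1) (wH V n x)`. -/
lemma map_wH (n : ℕ) (x : C.Chains n) : Φ (n + 1) (wH V n x) = wH V' n (Φ n x) := by
  have hT : ∀ n x, wH V' n (Φ n (incl (IsTarget V) x)) = 0 := fun n x => by
    rw [hΦ.target, wH_inclT hV']
  have hC : ∀ n x, wH V' n (Φ n (incl (IsCritical V) x)) = 0 := fun n x => by
    rw [hΦ.critical, wH_inclC]
  have hS : wH V' n (Φ n x) = wH V' n (Φ n (incl (IsSource V) (proj (IsSource V) x))) := by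
    conv_lhs => rw [← hV.partition n x]
    simp [hT, hC]
  have hS' : wH V' n (Φ n (C.d n (wH V n x))) =
      wH V' n (Φ n (incl (IsSource V) (proj (IsSource V) x))) := by
    conv_lhs => rw [← hV.partition n (C.d n (wH V n x))]
    simp [hT, hC, projS_d_wH hB]
  rw [hS, ← hS', hΦ.comm]
  have : wH V n x = incl (IsTarget V) (linInv (dTargetSource V n) (proj (IsSource V) x)) := rfl
  rw [this, hΦ.target, wH_d_inclT hB']

lemma map_wP (n : ℕ) (x : C.Chains n) : Φ n (wP V n x) = wP V' n (Φ n x) := by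
  cases n <;> simp [wP, hΦ.comm, hΦ.map_wH hV hB hV' hB']

/-- The morphism of W-reductions induced by a chain map preserving target and critical chains. -/
lemma isReductionMorphism : IsReductionMorphism C.d (wD V) (wF V) (wG V) (wH V)
    C'.d (wD V') (wF V') (wG V') (wH V') Φ
    (fun n => proj (IsCritical V') ∘ₗ Φ n ∘ₗ incl (IsCritical V)) := by
  have hP := hΦ.map_wP hV hB hV' hB'
  -- A value of the projector has only target and critical parts, and the image of the target part
  -- is invisible to the critical projection.
  have hf : ∀ n x, proj (IsCritical V') (Φ n (incl (IsCritical V) (proj (IsCritical V)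
      (wP V n x)))) = proj (IsCritical V') (Φ n (wP V n x)) := by
    intro n x
    conv_rhs => rw [← hV.partition n (wP V n x)]
    rw [projS_wP hV hB, map_zero, add_zero, map_add, map_add, hΦ.target,
      proj_incl_of_disjoint fun a h => h.2.2 h.1, zero_add]
  refine ⟨fun n => ?_, fun n => ?_, fun n => ?_, fun n => ?_, fun n => ?_⟩ <;> refine LinearMap.ext fun x => ?_ <;>
    simp only [LinearMap.comp_apply, wD_apply, wF_apply, wG_apply]
  · exact hΦ.comm n x
  · rw [← hΦ.critical, ← wP_d, hf, wP_d, hΦ.comm, hP]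
  · rw [hf, hP]
  · rw [← hΦ.critical, hP]
  · exact hΦ.map_wH hV hB hV' hB' n x

end Preserves

end Morphism

end CellComplex

/-! ### Replacing the small complex of a reduction along isomorphisms. -/

section Transport

variable {A B A' B' K K' : ℕ → Type*}
  [∀ n, AddCommMonoid (A n)] [∀ n, Module ℤ (A n)]
  [∀ n, AddCommMonoid (B n)] [∀ n, Module ℤ (B n)]
  [∀ n, AddCommMonoid (A' n)] [∀ n, Module ℤ (A' n)]
  [∀ n, AddCommMonoid (B' n)] [∀ n, Module ℤ (B' n)]
  [∀ n, AddCommMonoid (K n)] [∀ n, Module ℤ (K n)]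
  [∀ n, AddCommMonoid (K' n)] [∀ n, Module ℤ (K' n)]
  {dA : ∀ n, A (n + 1) →ₗ[ℤ] A n} {dB : ∀ n, B (n + 1) →ₗ[ℤ] B n}
  {f : ∀ n, A n →ₗ[ℤ] B n} {g : ∀ n, B n →ₗ[ℤ] A n} {h : ∀ n, A n →ₗ[ℤ] A (n + 1)}
  {dA' : ∀ n, A' (n + 1) →ₗ[ℤ] A' n} {dB' : ∀ n, B' (n + 1) →ₗ[ℤ] B' n}
  {f' : ∀ n, A' n →ₗ[ℤ] B' n} {g' : ∀ n, B' n →ₗ[ℤ] A' n} {h' : ∀ n, A' n →ₗ[ℤ] A' (n + 1)}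
  {Φ : ∀ n, A n →ₗ[ℤ] A' n} {Ψ : ∀ n, B n →ₗ[ℤ] B' n}
  {e : ∀ n, K n →ₗ[ℤ] B n} {e' : ∀ n, K' n →ₗ[ℤ] B' n}

lemma IsReduction.transport (H : IsReduction dA dB f g h) (he : ∀ n, Function.Bijective (e n)) :
    IsReduction dA (fun n => linInv (e n) ∘ₗ dB n ∘ₗ e (n + 1)) (fun n => linInv (e n) ∘ₗ f n)
      (fun n => g n ∘ₗ e n) h where
  dA_dA := H.dA_dA
  dB_dB n := by
    refine LinearMap.ext fun x => ?_
    have := LinearMap.congr_fun (H.dB_dB n) (e (n + 2) x)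
    simp only [LinearMap.comp_apply, apply_linInv_apply (he _)] at this ⊢
    simp [this]
  f_comm n := by
    refine LinearMap.ext fun x => ?_
    have := LinearMap.congr_fun (H.f_comm n) x
    simp only [LinearMap.comp_apply, apply_linInv_apply (he _)] at this ⊢
    rw [this]
  g_comm n := by
    refine LinearMap.ext fun x => ?_
    have := LinearMap.congr_fun (H.g_comm n) (e (n + 1) x)
    simp only [LinearMap.comp_apply, apply_linInv_apply (he _)] at this ⊢
    rw [this]
  f_g n := by
    refine LinearMap.ext fun x => ?_
    have := LinearMap.congr_fun (H.f_g n) (e n x)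
    simp only [LinearMap.comp_apply, LinearMap.id_apply] at this ⊢
    rw [this, linInv_apply_apply (he n)]
  homotopy_zero := by
    refine LinearMap.ext fun x => ?_
    have := LinearMap.congr_fun H.homotopy_zero x
    simp only [LinearMap.comp_apply, LinearMap.add_apply, apply_linInv_apply (he _)] at this ⊢
    rw [this]
  homotopy_succ n := by
    refine LinearMap.ext fun x => ?_
    have := LinearMap.congr_fun (H.homotopy_succ n) x
    simp only [LinearMap.comp_apply, LinearMap.add_apply, apply_linInv_apply (he _)] at this ⊢
    rw [this]
  f_h n := by
    refine LinearMap.ext fun x => ?_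
    have := LinearMap.congr_fun (H.f_h n) x
    simp only [LinearMap.comp_apply] at this ⊢
    simp [this]
  h_g n := by
    refine LinearMap.ext fun x => ?_
    exact LinearMap.congr_fun (H.h_g n) (e n x)
  h_h := H.h_h

lemma IsReductionMorphism.transport
    (H : IsReductionMorphism dA dB f g h dA' dB' f' g' h' Φ Ψ)
    (he : ∀ n, Function.Bijective (e n)) (he' : ∀ n, Function.Bijective (e' n))
    {Θ : ∀ n, K n →ₗ[ℤ] K' n} (hΘ : ∀ n x, e' n (Θ n x) = Ψ n (e n x)) :
    IsReductionMorphism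
      dA (fun n => linInv (e n) ∘ₗ dB n ∘ₗ e (n + 1)) (fun n => linInv (e n) ∘ₗ f n)
        (fun n => g n ∘ₗ e n) h
      dA' (fun n => linInv (e' n) ∘ₗ dB' n ∘ₗ e' (n + 1)) (fun n => linInv (e' n) ∘ₗ f' n)
        (fun n => g' n ∘ₗ e' n) h' Φ Θ where
  big_comm := H.big_comm
  small_comm n := by
    refine LinearMap.ext fun x => ?_
    have := LinearMap.congr_fun (H.small_comm n) (e (n + 1) x)
    apply (he' n).1
    simp only [LinearMap.comp_apply, apply_linInv_apply (he _), apply_linInv_apply (he' _),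
      hΘ] at this ⊢
    exact this
  f_comm n := by
    refine LinearMap.ext fun x => ?_
    have := LinearMap.congr_fun (H.f_comm n) x
    apply (he' n).1
    simp only [LinearMap.comp_apply, apply_linInv_apply (he _), apply_linInv_apply (he' _),
      hΘ] at this ⊢
    exact this
  g_comm n := by
    refine LinearMap.ext fun x => ?_
    have := LinearMap.congr_fun (H.g_comm n) (e n x)
    simp only [LinearMap.comp_apply, hΘ] at this ⊢
    exact this
  h_comm := H.h_comm

end Transport

namespace LPath

/-! ### Walks: the coordinates of interior s-paths -/

/-- The coordinates of an interior s-path. -/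
structure IsWalk (n p q : ℕ) (X Y : ℕ → ℕ) : Prop where
  zero : X 0 = 0 ∧ Y 0 = 0
  last : X n = p ∧ Y n = q
  step : ∀ k < n, X k ≤ X (k + 1) ∧ X (k + 1) ≤ X k + 1 ∧ Y k ≤ Y (k + 1) ∧
    Y (k + 1) ≤ Y k + 1 ∧ X k + Y k < X (k + 1) + Y (k + 1)

/-- The step `k` is diagonal. -/
def DiagAt (X Y : ℕ → ℕ) (k : ℕ) : Prop := X k < X (k + 1) ∧ Y k < Y (k + 1)

/-- The step `k` is vertical and the next one is horizontal. -/
def BendAt (X Y : ℕ → ℕ) (n k : ℕ) : Prop :=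
  k + 1 < n ∧ X k = X (k + 1) ∧ Y k < Y (k + 1) ∧ X (k + 1) < X (k + 2) ∧ Y (k + 1) = Y (k + 2)

/-- There is no event after the step `k`. -/
def QuietAfter (X Y : ℕ → ℕ) (n k : ℕ) : Prop :=
  ∀ j, k < j → j < n → ¬ DiagAt X Y j ∧ ¬ BendAt X Y n j

/-- Remove the value with index `w`. -/
def skip (w : ℕ) (X : ℕ → ℕ) (k : ℕ) : ℕ := if k < w then X k else X (k + 1)

lemma skip_of_lt {w k : ℕ} (h : k < w) (X : ℕ → ℕ) : skip w X k = X k := if_pos h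

lemma skip_of_le {w k : ℕ} (h : w ≤ k) (X : ℕ → ℕ) : skip w X k = X (k + 1) :=
  if_neg (not_lt.2 h)

variable {n p q : ℕ} {X Y : ℕ → ℕ}

/-- The face at its last bend has a last event which is diagonal. -/
lemma BendAt.skip {i : ℕ} (hi : BendAt X Y (n + 1) i)
    (hq : QuietAfter X Y (n + 1) i) :
    DiagAt (LPath.skip (i + 1) X) (LPath.skip (i + 1) Y) i ∧
      QuietAfter (LPath.skip (i + 1) X) (LPath.skip (i + 1) Y) n i := by
  constructor
  · simp only [DiagAt, skip_of_le (le_refl (i + 1)), skip_of_lt (Nat.lt_succ_self i)]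
    obtain ⟨_, _, _, _, _⟩ := hi
    simp only [show i + 1 + 1 = i + 2 from rfl]
    omega
  · intro j hij hj
    have := hq (j + 1) (by omega) (by omega)
    simp only [DiagAt, BendAt, skip_of_le (show i + 1 ≤ j by omega),
      skip_of_le (show i + 1 ≤ j + 1 by omega), skip_of_le (show i + 1 ≤ j + 2 by omega)] at this ⊢
    refine ⟨this.1, fun h => this.2 ⟨by omega, h.2⟩⟩

namespace IsWalk

lemma X_le (h : IsWalk n p q X Y) {k : ℕ} (hk : k ≤ n) : X k ≤ p := by
  obtain ⟨d, rfl⟩ := Nat.exists_eq_add_of_le hk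
  rw [← h.last.1]
  have : ∀ e ≤ d, X k ≤ X (k + e) := by
    intro e
    induction e with
    | zero => simp
    | succ e ih =>
      intro he
      have := h.step (k + e) (by omega)
      have := ih (by omega)
      rw [← add_assoc]
      omega
  exact this d le_rfl

lemma swap (h : IsWalk n p q X Y) : IsWalk n q p Y X where
  zero := h.zero.symm
  last := h.last.symm
  step k hk := by have := h.step k hk; omega

lemma Y_le (h : IsWalk n p q X Y) {k : ℕ} (hk : k ≤ n) : Y k ≤ q := h.swap.X_le hk

/-- Discrete intermediate value theorem: the first coordinate grows by at most one at each step. -/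
lemma exists_X_eq (h : IsWalk n p q X Y) {m : ℕ} (hm : m ≤ p) : ∃ k ≤ n, X k = m := by
  have : ∀ k ≤ n, m ≤ X k → ∃ j ≤ k, X j = m := by
    intro k
    induction k with
    | zero =>
      intro _ hm'
      exact ⟨0, le_rfl, by have := h.zero.1; omega⟩
    | succ k ih =>
      intro hk hm'
      by_cases hX : m ≤ X k
      · obtain ⟨j, hj, hj'⟩ := ih (by omega) hX
        exact ⟨j, by omega, hj'⟩
      · have := h.step k (by omega)
        exact ⟨k + 1, le_rfl, by omega⟩
  exact this n le_rfl (by rw [h.last.1]; exact hm)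

/-- Removing the vertex of a bend. -/
lemma skip_bend (h : IsWalk (n + 1) p q X Y) {i : ℕ} (hi : BendAt X Y (n + 1) i) :
    IsWalk n p q (skip (i + 1) X) (skip (i + 1) Y) where
  zero := by
    simp only [skip_of_lt (Nat.succ_pos i)]
    exact h.zero
  last := by
    simp only [skip_of_le (show i + 1 ≤ n by have := hi.1; omega)]
    exact h.last
  step k hk := by
    rcases lt_trichotomy k i with hki | rfl | hki
    · simp only [skip_of_lt (show k + 1 < i + 1 by omega), skip_of_lt (show k < i + 1 by omega)]
      exact h.step k (by omega)
    · simp only [skip_of_le (le_refl (k + 1)), skip_of_lt (Nat.lt_succ_self k)]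
      obtain ⟨_, _, _, _, _⟩ := hi
      have := h.step k (by omega)
      have := h.step (k + 1) (by omega)
      simp only [show k + 1 + 1 = k + 2 from rfl] at this ⊢
      omega
    · simp only [skip_of_le (show i + 1 ≤ k + 1 by omega), skip_of_le (show i + 1 ≤ k by omega)]
      exact h.step (k + 1) (by omega)

/-- A diagonal step can be replaced by a bend. -/
lemma exists_bend (h : IsWalk n p q X Y) {i : ℕ} (hi : i < n) (hd : DiagAt X Y i)
    (hq : QuietAfter X Y n i) :
    ∃ X' Y', IsWalk (n + 1) p q X' Y' ∧ BendAt X' Y' (n + 1) i ∧ QuietAfter X' Y' (n + 1) i ∧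
      skip (i + 1) X' = X ∧ skip (i + 1) Y' = Y := by
  -- The inserted vertex is `(X i, Y (i + 1))`: `X'` repeats the value `X i` and `Y'` repeats the
  -- value `Y (i + 1)`, so the vertical step comes first.
  have e1 : ∀ k ≤ i, (fun k => if k ≤ i then X k else X (k - 1)) k = X k := fun k hk => if_pos hk
  have e2 : ∀ k, i ≤ k → (fun k => if k ≤ i then X k else X (k - 1)) (k + 1) = X k :=
    fun k hk => if_neg (by omega)
  have e3 : ∀ k ≤ i + 1, (fun k => if k ≤ i + 1 then Y k else Y (k - 1)) k = Y k :=
    fun k hk => if_pos hk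
  have e4 : ∀ k, i + 1 ≤ k → (fun k => if k ≤ i + 1 then Y k else Y (k - 1)) (k + 1) = Y k :=
    fun k hk => if_neg (by omega)
  generalize (fun k => if k ≤ i then X k else X (k - 1)) = X' at e1 e2
  generalize (fun k => if k ≤ i + 1 then Y k else Y (k - 1)) = Y' at e3 e4
  refine ⟨X', Y', ⟨?_, ?_, ?_⟩, ⟨by omega, ?_⟩, ?_, ?_, ?_⟩
  · rw [e1 0 (by omega), e3 0 (by omega)]
    exact h.zero
  · rw [e2 n (by omega), e4 n (by omega)]
    exact h.last
  · intro k hk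
    rcases lt_trichotomy k i with hki | rfl | hki
    · rw [e1 k (by omega), e1 (k + 1) (by omega), e3 k (by omega), e3 (k + 1) (by omega)]
      exact h.step k (by omega)
    · rw [e1 k le_rfl, e2 k le_rfl, e3 k (by omega), e3 (k + 1) le_rfl]
      have := h.step k (by omega)
      have := hd.2
      omega
    · obtain ⟨k, rfl⟩ : ∃ m, k = m + 1 := ⟨k - 1, by omega⟩
      rw [e2 k (by omega), e2 (k + 1) (by omega), e4 (k + 1) (by omega)]
      rcases Nat.lt_or_ge k (i + 1) with hk' | hk'
      · obtain rfl : k = i := by omega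
        rw [e3 (k + 1) le_rfl]
        have := h.step k (by omega)
        have := hd.1
        omega
      · rw [e4 k hk']
        exact h.step k (by omega)
  · rw [e1 i le_rfl, e2 i le_rfl, e2 (i + 1) (by omega), e3 i (by omega), e3 (i + 1) le_rfl,
      e4 (i + 1) le_rfl]
    exact ⟨rfl, hd.2, hd.1, rfl⟩
  · intro j hij hj
    obtain ⟨j, rfl⟩ : ∃ m, j = m + 1 := ⟨j - 1, by omega⟩
    have hX := e2 j (by omega)
    have hX1 := e2 (j + 1) (by omega)
    have hX2 := e2 (j + 2) (by omega)
    have hY1 := e4 (j + 1) (by omega)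
    have hY2 := e4 (j + 2) (by omega)
    simp only [DiagAt, BendAt]
    rw [show j + 1 + 2 = j + 2 + 1 by rfl, hX, hX1, hX2, hY1, hY2]
    rcases Nat.lt_or_ge j (i + 1) with hj' | hj'
    · obtain rfl : j = i := by omega
      rw [e3 (j + 1) le_rfl]
      exact ⟨fun h => lt_irrefl _ h.2, fun h => lt_irrefl _ h.2.2.1⟩
    · rw [e4 j hj']
      have := hq j (by omega) (by omega)
      exact ⟨this.1, fun h => this.2 ⟨by omega, h.2⟩⟩
  · ext k
    rcases Nat.lt_or_ge k (i + 1) with hk | hk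
    · rw [skip_of_lt hk, e1 k (by omega)]
    · rw [skip_of_le hk, e2 k (by omega)]
  · ext k
    rcases Nat.lt_or_ge k (i + 1) with hk | hk
    · rw [skip_of_lt hk, e3 k (by omega)]
    · rw [skip_of_le hk, e4 k (by omega)]

/-- Among the faces of a walk whose last event is a bend, the face at this bend is the lowest one,
if only the walks whose last event is diagonal are considered. -/
lemma descent (h : IsWalk (n + 1) p q X Y) {i : ℕ} (hi : BendAt X Y (n + 1) i)
    (hq : QuietAfter X Y (n + 1) i) {w : ℕ} (hw : w ≤ n + 1) (hwi : w ≠ i + 1)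
    (hs : IsWalk n p q (skip w X) (skip w Y)) {m : ℕ} (hm : m < n)
    (hd : DiagAt (skip w X) (skip w Y) m) (hq' : QuietAfter (skip w X) (skip w Y) n m) :
    Y w + X (i + 1) < Y (i + 1) + X w := by
  -- Removing an end vertex would leave a walk that does not start at the origin or does not end at
  -- `(p, q)`.
  have hw0 : w ≠ 0 := by
    rintro rfl
    have h1 := hs.zero
    simp only [skip_of_le le_rfl] at h1
    have h2 := h.step 0 (by omega)
    rw [h1.1, h1.2] at h2
    omega
  have hwn : w ≠ n + 1 := by
    rintro rfl
    have h1 := hs.last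
    simp only [skip_of_lt (Nat.lt_succ_self n)] at h1
    have h2 := h.step n (by omega)
    rw [h1.1, h1.2, h.last.1, h.last.2] at h2
    omega
  obtain ⟨u, rfl⟩ : ∃ u, w = u + 1 := ⟨w - 1, by omega⟩
  -- The two steps around the removed vertex merge into one step of size at most one in each
  -- direction, so one of them is horizontal and the other vertical.
  have hu := hs.step u (by omega)
  simp only [skip_of_lt (Nat.lt_succ_self u), skip_of_le (le_refl (u + 1))] at hu
  have h1 := h.step u (by omega)
  have h2 := h.step (u + 1) (by omega)
  rcases lt_trichotomy u i with hui | rfl | hui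
  · rcases Nat.lt_or_ge (u + 1) i with hui' | hui'
    -- A removal strictly before the bend leaves it in place, shifted by one. The last event of the
    -- face would be this bend, or a later diagonal inherited from the original walk.
    · exfalso
      obtain ⟨i, rfl⟩ : ∃ j, i = j + 1 := ⟨i - 1, by omega⟩
      have hb : BendAt (skip (u + 1) X) (skip (u + 1) Y) n i := by
        simp only [BendAt, skip_of_le (show u + 1 ≤ i by omega),
          skip_of_le (show u + 1 ≤ i + 1 by omega), skip_of_le (show u + 1 ≤ i + 2 by omega)]
        exact ⟨by have := hi.1; omega, hi.2⟩
      rcases lt_trichotomy m i with hmi | rfl | hmi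
      · exact (hq' i hmi (by have := hb.1; omega)).2 hb
      · exact hd.1.ne hb.2.1
      · refine (hq (m + 1) (by omega) (by omega)).1 ?_
        simpa only [DiagAt, skip_of_le (show u + 1 ≤ m by omega),
          skip_of_le (show u + 1 ≤ m + 1 by omega)] using hd
    -- The removed vertex is the foot of the vertical step of the bend: same abscissa, smaller
    -- ordinate.
    · obtain rfl : i = u + 1 := by omega
      obtain ⟨_, _, _, _, _⟩ := hi
      omega
  · exact absurd rfl hwi
  -- Past the bend, vertical followed by horizontal is excluded, so the first of the two merged
  -- steps is the horizontal one.
  · have hH : X u < X (u + 1) ∧ Y u = Y (u + 1) := by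
      have h3 := (hq u hui (by omega)).2
      have h4 := (hq u hui (by omega)).1
      simp only [BendAt, DiagAt, show u + 1 + 1 = u + 2 from rfl] at h3 h4 h1 h2 hu
      omega
    -- Without later events, a step preceding a horizontal one is itself horizontal. Going back to
    -- the bend, the removed vertex lies on the same horizontal line, strictly to the right.
    have key : ∀ d u, u = i + 1 + d → u < n + 1 → X u < X (u + 1) ∧ Y u = Y (u + 1) →
        Y (u + 1) = Y (i + 1) ∧ X (i + 1) < X (u + 1) := by
      intro d
      induction d with
      | zero =>
        rintro u rfl hu hH
        simp only [add_zero] at hH ⊢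
        omega
      | succ d ih =>
        rintro u rfl hu hH
        have hs := h.step (i + 1 + d) (by omega)
        have h3 := (hq (i + 1 + d) (by omega) (by omega)).2
        have h4 := (hq (i + 1 + d) (by omega) (by omega)).1
        have := ih (i + 1 + d) rfl (by omega) (by
          simp only [BendAt, DiagAt, ← add_assoc,
            show i + 1 + d + 2 = i + 1 + d + 1 + 1 from rfl] at h3 h4 hH hs
          omega)
        simp only [← add_assoc] at hH ⊢
        omega
    have := key (u - (i + 1)) u (by omega) (by omega) hH
    omega

/-- The only walk without event. -/
lemma eq_of_quiet (h : IsWalk n p q X Y) (hq : ∀ j < n, ¬ DiagAt X Y j ∧ ¬ BendAt X Y n j) :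
    p + q = n ∧ ∀ k ≤ n, X k = min k p ∧ Y k = k - p := by
  -- Without diagonals each step adds exactly one to the sum of the coordinates.
  have hsum : ∀ k ≤ n, X k + Y k = k := by
    intro k
    induction k with
    | zero => have := h.zero; omega
    | succ k ih =>
      intro hk
      have h1 := h.step k (by omega)
      have h2 := (hq k (by omega)).1
      have := ih (by omega)
      simp only [DiagAt] at h2
      omega
  -- Without bends, a vertical step is followed only by vertical steps.
  have hV : ∀ k < n, Y k < Y (k + 1) → ∀ d, k + d < n → Y (k + d) < Y (k + d + 1) := by
    intro k hk hk' d
    induction d with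
    | zero => intro _; exact hk'
    | succ d ih =>
      intro hd
      have h1 := ih (by omega)
      have h2 := (hq (k + d) (by omega)).2
      have h3 := h.step (k + d) (by omega)
      have h4 := h.step (k + d + 1) (by omega)
      have h5 := hsum (k + d) (by omega)
      have h6 := hsum (k + d + 1) (by omega)
      have h7 := hsum (k + d + 2) (by omega)
      simp only [BendAt, ← add_assoc, show k + d + 1 + 1 = k + d + 2 from rfl] at *
      omega
  have hX : ∀ k < n, Y k < Y (k + 1) → X k = p := by
    intro k hk hk'
    have : ∀ d, k + d ≤ n → X (k + d) = X k := by
      intro d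
      induction d with
      | zero => simp
      | succ d ih =>
        intro hd
        have h1 := ih (by omega)
        have h2 := hV k hk hk' d (by omega)
        have h3 := h.step (k + d) (by omega)
        have h4 := hsum (k + d) (by omega)
        have h5 := hsum (k + d + 1) (by omega)
        rw [← add_assoc]
        omega
    have := this (n - k) (by omega)
    rw [← this, show k + (n - k) = n by omega, h.last.1]
  have hY : ∀ k ≤ n, 0 < Y k → X k = p := by
    intro k
    induction k with
    | zero => intro _ h0; have := h.zero; omega
    | succ k ih =>
      intro hk h0
      have h1 := hsum k (by omega)
      have h2 := hsum (k + 1) (by omega)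
      have h3 := h.X_le hk
      rcases Nat.eq_zero_or_pos (Y k) with h4 | h4
      · have := hX k (by omega) (by omega)
        have := h.step k (by omega)
        omega
      · have := ih (by omega) h4
        have := h.step k (by omega)
        omega
  constructor
  · have := hsum n le_rfl
    rw [h.last.1, h.last.2] at this
    exact this
  · intro k hk
    have h1 := hsum k hk
    have h2 := hY k hk
    have h3 := h.X_le hk
    omega

end IsWalk

/-- A walk has a last event or no event at all. -/
lemma exists_last_event (X Y : ℕ → ℕ) (n : ℕ) :
    (∃ i < n, DiagAt X Y i ∧ QuietAfter X Y n i) ∨ (∃ i < n, BendAt X Y n i ∧ QuietAfter X Y n i) ∨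
      ∀ j < n, ¬ DiagAt X Y j ∧ ¬ BendAt X Y n j := by
  have : ∀ m ≤ n, (∃ i < n, DiagAt X Y i ∧ QuietAfter X Y n i) ∨
      (∃ i < n, BendAt X Y n i ∧ QuietAfter X Y n i) ∨
      ∀ j, m ≤ j → j < n → ¬ DiagAt X Y j ∧ ¬ BendAt X Y n j := by
    intro m hm
    induction hm using Nat.decreasingInduction with
    | self => exact Or.inr (Or.inr fun j h1 h2 => by omega)
    | of_succ k hk ih =>
      rcases ih with h | h | h
      · exact Or.inl h
      · exact Or.inr (Or.inl h)
      · by_cases hd : DiagAt X Y k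
        · exact Or.inl ⟨k, hk, hd, fun j h1 h2 => h j h1 h2⟩
        · by_cases hb : BendAt X Y n k
          · exact Or.inr (Or.inl ⟨k, hk, hb, fun j h1 h2 => h j h1 h2⟩)
          · refine Or.inr (Or.inr fun j h1 h2 => ?_)
            rcases h1.eq_or_lt with rfl | h1
            · exact ⟨hd, hb⟩
            · exact h j h1 h2
  simpa using this 0 (Nat.zero_le n)

end LPath

/-! ### From lattice paths to walks; the pairing of paths and its weight. -/

namespace LPath

variable {n p q : ℕ}

section Congr

variable {X Y X' Y' : ℕ → ℕ} (hX : ∀ k ≤ n, X' k = X k) (hY : ∀ k ≤ n, Y' k = Y k)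
include hX hY

lemma IsWalk.congr (h : IsWalk n p q X Y) : IsWalk n p q X' Y' where
  zero := by rw [hX 0 (by omega), hY 0 (by omega)]; exact h.zero
  last := by rw [hX n le_rfl, hY n le_rfl]; exact h.last
  step k hk := by
    rw [hX k (by omega), hY k (by omega), hX (k + 1) (by omega), hY (k + 1) (by omega)]
    exact h.step k hk

lemma diagAt_congr {k : ℕ} (hk : k < n) : DiagAt X' Y' k ↔ DiagAt X Y k := by
  rw [DiagAt, hX k (by omega), hY k (by omega), hX (k + 1) (by omega), hY (k + 1) (by omega),
    DiagAt]

lemma bendAt_congr (k : ℕ) : BendAt X' Y' n k ↔ BendAt X Y n k := by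
  rw [BendAt, BendAt]
  refine and_congr_right fun hk => ?_
  rw [hX k (by omega), hY k (by omega), hX (k + 1) (by omega), hY (k + 1) (by omega),
    hX (k + 2) (by omega), hY (k + 2) (by omega)]

lemma quietAfter_congr (k : ℕ) : QuietAfter X' Y' n k ↔ QuietAfter X Y n k :=
  forall_congr' fun j => forall_congr' fun _ => forall_congr' fun hj => by
    rw [diagAt_congr hX hY hj, bendAt_congr hX hY j]

end Congr

/-- The first coordinates of a path. -/
def xs (π : LPath n p q) (k : ℕ) : ℕ := (π ⟨min k n, by omega⟩).1

/-- The second coordinates of a path. -/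
def ys (π : LPath n p q) (k : ℕ) : ℕ := (π ⟨min k n, by omega⟩).2

lemma xs_val (π : LPath n p q) (i : Fin (n + 1)) : π.xs i = (π i).1 := by
  have : (⟨min i n, by omega⟩ : Fin (n + 1)) = i := Fin.ext (by simp; omega)
  rw [xs, this]

lemma ys_val (π : LPath n p q) (i : Fin (n + 1)) : π.ys i = (π i).2 := by
  have : (⟨min i n, by omega⟩ : Fin (n + 1)) = i := Fin.ext (by simp; omega)
  rw [ys, this]

lemma ext_coords {π π' : LPath n p q} (hx : ∀ k ≤ n, π.xs k = π'.xs k)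
    (hy : ∀ k ≤ n, π.ys k = π'.ys k) : π = π' := by
  refine OrderHom.ext _ _ (funext fun i => Prod.ext (Fin.ext ?_) (Fin.ext ?_))
  · rw [← xs_val, ← xs_val, hx i (by omega)]
  · rw [← ys_val, ← ys_val, hy i (by omega)]

lemma vert_iff (π : LPath n p q) (i : Fin n) :
    π.Vert i ↔ π.xs i = π.xs (i + 1) ∧ π.ys i < π.ys (i + 1) := by
  rw [Vert, Fin.ext_iff, Fin.lt_def, ← xs_val, ← xs_val, ← ys_val, ← ys_val]
  rfl

lemma horiz_iff (π : LPath n p q) (i : Fin n) :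
    π.Horiz i ↔ π.xs i < π.xs (i + 1) ∧ π.ys i = π.ys (i + 1) := by
  rw [Horiz, Fin.ext_iff, Fin.lt_def, ← xs_val, ← xs_val, ← ys_val, ← ys_val]
  rfl

lemma diag_iff (π : LPath n p q) (i : Fin n) : π.Diag i ↔ DiagAt π.xs π.ys i := by
  rw [Diag, Fin.lt_def, Fin.lt_def, ← xs_val, ← xs_val, ← ys_val, ← ys_val]
  rfl

lemma bend_iff (π : LPath n p q) (i : Fin n) : π.Bend i ↔ BendAt π.xs π.ys n i := by
  rw [Bend, vert_iff, BendAt]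
  constructor
  · rintro ⟨h, j, hj, hj'⟩
    rw [horiz_iff, hj] at hj'
    exact ⟨by omega, h.1, h.2, hj'⟩
  · rintro ⟨h, h1, h2, h3⟩
    exact ⟨⟨h1, h2⟩, ⟨i + 1, h⟩, rfl, (horiz_iff π ⟨i + 1, h⟩).2 h3⟩

lemma noEventAfter_iff (π : LPath n p q) (i : Fin n) :
    π.NoEventAfter i ↔ QuietAfter π.xs π.ys n i := by
  constructor
  · intro h j hij hj
    have := h ⟨j, hj⟩ hij
    rwa [diag_iff, bend_iff] at this
  · intro h j hij
    rw [diag_iff, bend_iff]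
    exact h j hij j.2

/-- For a monotone path, surjectivity of the projections means that the endpoints are the extreme
corners and that no coordinate value is jumped over. Strictness means that each step moves. -/
lemma isInterior_iff (π : LPath n p q) : π.IsInterior ↔ IsWalk n p q π.xs π.ys := by
  have mono : ∀ i j : Fin (n + 1), i ≤ j → π.xs i ≤ π.xs j ∧ π.ys i ≤ π.ys j := fun i j hij => by
    rw [xs_val, xs_val, ys_val, ys_val]
    exact π.monotone hij
  constructor
  · rintro ⟨hs, hx, hy⟩
    have hx' : ∀ m ≤ p, ∃ j : Fin (n + 1), π.xs j = m := fun m hm => by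
      obtain ⟨j, hj⟩ := hx ⟨m, by omega⟩
      exact ⟨j, by rw [xs_val]; exact congrArg Fin.val hj⟩
    have hy' : ∀ m ≤ q, ∃ j : Fin (n + 1), π.ys j = m := fun m hm => by
      obtain ⟨j, hj⟩ := hy ⟨m, by omega⟩
      exact ⟨j, by rw [ys_val]; exact congrArg Fin.val hj⟩
    have hxp : ∀ k, π.xs k ≤ p := fun k => Nat.le_of_lt_succ (π ⟨min k n, by omega⟩).1.2
    have hyq : ∀ k, π.ys k ≤ q := fun k => Nat.le_of_lt_succ (π ⟨min k n, by omega⟩).2.2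
    refine ⟨⟨?_, ?_⟩, ⟨?_, ?_⟩, fun k hk => ?_⟩
    · obtain ⟨j, hj⟩ := hx' 0 (Nat.zero_le _)
      exact Nat.le_zero.1 ((mono 0 j (Fin.zero_le j)).1.trans_eq hj)
    · obtain ⟨j, hj⟩ := hy' 0 (Nat.zero_le _)
      exact Nat.le_zero.1 ((mono 0 j (Fin.zero_le j)).2.trans_eq hj)
    · obtain ⟨j, hj⟩ := hx' p le_rfl
      exact le_antisymm (hxp n) (hj.symm.trans_le (mono j (Fin.last n) (Fin.le_last j)).1)
    · obtain ⟨j, hj⟩ := hy' q le_rfl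
      exact le_antisymm (hyq n) (hj.symm.trans_le (mono j (Fin.last n) (Fin.le_last j)).2)
    · have h1 := mono ⟨k, by omega⟩ ⟨k + 1, by omega⟩ (Nat.le_succ k)
      simp only at h1
      refine ⟨h1.1, ?_, h1.2, ?_, ?_⟩
      · by_contra hlt
        obtain ⟨j, hj⟩ := hx' (π.xs k + 1) (by have := hxp (k + 1); omega)
        rcases Nat.lt_or_ge k j with h | h
        · have := (mono ⟨k + 1, by omega⟩ j h).1
          simp only at this
          omega
        · have := (mono j ⟨k, by omega⟩ h).1
          simp only at this
          omega
      · by_contra hlt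
        obtain ⟨j, hj⟩ := hy' (π.ys k + 1) (by have := hyq (k + 1); omega)
        rcases Nat.lt_or_ge k j with h | h
        · have := (mono ⟨k + 1, by omega⟩ j h).2
          simp only at this
          omega
        · have := (mono j ⟨k, by omega⟩ h).2
          simp only at this
          omega
      · have hne : π ⟨k, by omega⟩ ≠ π ⟨k + 1, by omega⟩ :=
          fun h => absurd (congrArg Fin.val (hs.injective h)) (by simp)
        by_contra hlt
        refine hne (Prod.ext (Fin.ext ?_) (Fin.ext ?_))
        · rw [← xs_val, ← xs_val]
          simp only
          omega
        · rw [← ys_val, ← ys_val]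
          simp only
          omega
  · intro h
    refine ⟨Fin.strictMono_iff_lt_succ.2 fun i => ?_, fun m => ?_, fun m => ?_⟩
    · refine lt_of_le_of_ne (π.monotone (Fin.castSucc_lt_succ).le) fun heq => ?_
      have h1 := h.step i i.2
      have h2 := π.xs_val i.castSucc
      have h3 := π.ys_val i.castSucc
      rw [heq, ← xs_val] at h2
      rw [heq, ← ys_val] at h3
      simp only [Fin.val_castSucc, Fin.val_succ] at h2 h3
      omega
    · obtain ⟨k, hk, hk'⟩ := h.exists_X_eq (Nat.le_of_lt_succ m.2)
      exact ⟨⟨k, by omega⟩, Fin.ext (by rw [← hk', ← xs_val])⟩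
    · obtain ⟨k, hk, hk'⟩ := h.swap.exists_X_eq (Nat.le_of_lt_succ m.2)
      exact ⟨⟨k, by omega⟩, Fin.ext (by rw [← hk', ← ys_val])⟩

lemma IsWalk.exists_path {X Y : ℕ → ℕ} (h : IsWalk n p q X Y) :
    ∃ π : LPath n p q, (∀ k ≤ n, π.xs k = X k) ∧ ∀ k ≤ n, π.ys k = Y k := by
  refine ⟨⟨fun i => (⟨X i, Nat.lt_succ_of_le (h.X_le (Nat.le_of_lt_succ i.2))⟩,
    ⟨Y i, Nat.lt_succ_of_le (h.Y_le (Nat.le_of_lt_succ i.2))⟩),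
    Fin.monotone_iff_le_succ.2 fun i => ?_⟩, fun k hk => ?_, fun k hk => ?_⟩
  · have := h.step i i.2
    exact ⟨this.1, this.2.2.1⟩
  · exact congrArg X (min_eq_left hk)
  · exact congrArg Y (min_eq_left hk)

/-- The face of a path. -/
def face (π : LPath (n + 1) p q) (v : Fin (n + 2)) : LPath n p q :=
  π.comp (Fin.succAboveOrderEmb v).toOrderHom

lemma face_apply (π : LPath (n + 1) p q) (v : Fin (n + 2)) (j : Fin (n + 1)) :
    π.face v j = π (v.succAbove j) := rfl

lemma val_succAbove (v : Fin (n + 2)) (j : Fin (n + 1)) :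
    (v.succAbove j : ℕ) = if (j : ℕ) < v then (j : ℕ) else j + 1 := by
  rw [Fin.succAbove]
  simp only [Fin.lt_def, Fin.val_castSucc]
  split_ifs <;> simp

lemma xs_face (π : LPath (n + 1) p q) (v : Fin (n + 2)) {k : ℕ} (hk : k ≤ n) :
    (π.face v).xs k = skip v π.xs k := by
  have h := xs_val (π.face v) ⟨k, by omega⟩
  rw [face_apply, ← xs_val, val_succAbove] at h
  rw [skip, h]
  split_ifs <;> rfl

lemma ys_face (π : LPath (n + 1) p q) (v : Fin (n + 2)) {k : ℕ} (hk : k ≤ n) :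
    (π.face v).ys k = skip v π.ys k := by
  have h := ys_val (π.face v) ⟨k, by omega⟩
  rw [face_apply, ← ys_val, val_succAbove] at h
  rw [skip, h]
  split_ifs <;> rfl

/-- If `v ≠ w`, the vertex `π v` occurs in `π.face w`, but not at the same place in `π.face v`,
since `π` is injective. -/
lemma IsInterior.face_injective {π : LPath (n + 1) p q} (h : π.IsInterior) {v w : Fin (n + 2)}
    (hvw : π.face v = π.face w) : v = w := by
  by_contra hne
  obtain ⟨j, hj⟩ := Fin.exists_succAbove_eq hne
  have h1 := DFunLike.congr_fun hvw j
  rw [face_apply, face_apply, hj] at h1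
  exact v.succAbove_ne j (h.1.injective h1)

/-- The last event of the path is a diagonal step. -/
def EndsDiag (π : LPath n p q) : Prop := ∃ i < n, DiagAt π.xs π.ys i ∧ QuietAfter π.xs π.ys n i

/-- The last event of the path is a bend. -/
def EndsBend (π : LPath n p q) : Prop := ∃ i < n, BendAt π.xs π.ys n i ∧ QuietAfter π.xs π.ys n i

/-- There is no event in the path. -/
def Quiet (π : LPath n p q) : Prop := ∀ j < n, ¬ DiagAt π.xs π.ys j ∧ ¬ BendAt π.xs π.ys n j

lemma endsDiag_or (π : LPath n p q) : π.EndsDiag ∨ π.EndsBend ∨ π.Quiet :=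
  exists_last_event π.xs π.ys n

lemma Quiet.not_endsDiag {π : LPath n p q} (h : π.Quiet) : ¬ π.EndsDiag :=
  fun ⟨i, hi, h', _⟩ => (h i hi).1 h'

lemma Quiet.not_endsBend {π : LPath n p q} (h : π.Quiet) : ¬ π.EndsBend :=
  fun ⟨i, hi, h', _⟩ => (h i hi).2 h'

lemma EndsDiag.not_endsBend {π : LPath n p q} (h : π.EndsDiag) : ¬ π.EndsBend := by
  rintro ⟨j, hj, hb, hqj⟩
  obtain ⟨i, hi, hd, hqi⟩ := h
  rcases lt_trichotomy i j with h | rfl | h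
  · exact (hqi j h hj).2 hb
  · exact hd.1.ne hb.2.1
  · exact (hqj i h hi).1 hd

lemma paired_iff (π : LPath n p q) (π' : LPath (n + 1) p q) :
    π.Paired π' ↔ ∃ i : Fin (n + 1), BendAt π'.xs π'.ys (n + 1) i ∧
      QuietAfter π'.xs π'.ys (n + 1) i ∧ π = π'.face i.succ := by
  simp only [Paired, bend_iff, noEventAfter_iff]
  refine exists_congr fun i => and_congr_right fun _ => and_congr_right fun _ => ?_
  exact ⟨fun h => OrderHom.ext _ _ (funext h), fun h j => by rw [h]; rfl⟩

lemma Paired.endsBend {π : LPath n p q} {π' : LPath (n + 1) p q} (h : π.Paired π') :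
    π'.EndsBend := by
  obtain ⟨i, hb, hq, -⟩ := (paired_iff _ _).1 h
  exact ⟨i, i.2, hb, hq⟩

lemma Paired.isInterior {π : LPath n p q} {π' : LPath (n + 1) p q} (h : π.Paired π')
    (h' : π'.IsInterior) : π.IsInterior := by
  obtain ⟨i, hb, hq, rfl⟩ := (paired_iff _ _).1 h
  rw [isInterior_iff] at h' ⊢
  exact (h'.skip_bend hb).congr (fun k hk => xs_face _ _ hk) (fun k hk => ys_face _ _ hk)

lemma EndsBend.exists_paired {π' : LPath (n + 1) p q} (h : π'.EndsBend) :
    ∃ π : LPath n p q, π.Paired π' := by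
  obtain ⟨i, hi, hb, hq⟩ := h
  exact ⟨π'.face (Fin.succ ⟨i, hi⟩), (paired_iff _ _).2 ⟨⟨i, hi⟩, hb, hq, rfl⟩⟩

lemma face_bend_diagAt {π' : LPath (n + 1) p q} {i : Fin (n + 1)}
    (hb : BendAt π'.xs π'.ys (n + 1) i) (hq : QuietAfter π'.xs π'.ys (n + 1) i) :
    DiagAt (π'.face i.succ).xs (π'.face i.succ).ys i ∧
      QuietAfter (π'.face i.succ).xs (π'.face i.succ).ys n i := by
  rw [diagAt_congr (fun k hk => xs_face _ _ hk) (fun k hk => ys_face _ _ hk)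
    (by have := hb.1; omega),
    quietAfter_congr (fun k hk => xs_face _ _ hk) (fun k hk => ys_face _ _ hk)]
  exact hb.skip hq

lemma Paired.endsDiag {π : LPath n p q} {π' : LPath (n + 1) p q} (h : π.Paired π') :
    π.EndsDiag := by
  obtain ⟨i, hb, hq, rfl⟩ := (paired_iff _ _).1 h
  exact ⟨i, by have := hb.1; omega, face_bend_diagAt hb hq⟩

lemma EndsDiag.exists_paired {π : LPath n p q} (h : π.EndsDiag) (hπ : π.IsInterior) :
    ∃ π' : LPath (n + 1) p q, π'.IsInterior ∧ π.Paired π' := by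
  obtain ⟨i, hi, hd, hq⟩ := h
  obtain ⟨X', Y', hw, hb', hq', hX, hY⟩ := ((isInterior_iff π).1 hπ).exists_bend hi hd hq
  obtain ⟨π', hxs, hys⟩ := hw.exists_path
  refine ⟨π', (isInterior_iff π').2 (hw.congr hxs hys), (paired_iff _ _).2
    ⟨⟨i, by omega⟩, (bendAt_congr hxs hys _).2 hb', (quietAfter_congr hxs hys _).2 hq',
      ext_coords (fun k hk => ?_) (fun k hk => ?_)⟩⟩
  · rw [xs_face _ _ hk, ← hX, skip, skip, hxs k (by omega), hxs (k + 1) (by omega)]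
    rfl
  · rw [ys_face _ _ hk, ← hY, skip, skip, hys k (by omega), hys (k + 1) (by omega)]
    rfl

/-- The last event of `π` is diagonal, and its position recovers the index of the bend. The bend
vertex is then determined by its neighbours: abscissa of the preceding one, ordinate of the
following one. -/
lemma Paired.right_unique {π : LPath n p q} {π₁ π₂ : LPath (n + 1) p q} (h₁ : π.Paired π₁)
    (h₂ : π.Paired π₂) : π₁ = π₂ := by
  obtain ⟨i, hb, hq, rfl⟩ := (paired_iff _ _).1 h₁
  obtain ⟨j, hb', hq', h⟩ := (paired_iff _ _).1 h₂
  have hd := face_bend_diagAt hb hq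
  have hd' := face_bend_diagAt hb' hq'
  rw [← h] at hd'
  have hi := hb.1
  have hj := hb'.1
  obtain rfl : i = j := by
    rcases lt_trichotomy i j with hij | hij | hij
    · exact absurd hd'.1 (hd.2 j hij (by omega)).1
    · exact hij
    · exact absurd hd.1 (hd'.2 i hij (by omega)).1
  have key : ∀ k ≤ n + 1, k ≠ i + 1 → π₁.xs k = π₂.xs k ∧ π₁.ys k = π₂.ys k := by
    intro k hk hki
    have hne : (⟨k, by omega⟩ : Fin (n + 2)) ≠ i.succ := fun h => hki (congrArg Fin.val h)
    obtain ⟨m, hm⟩ := Fin.exists_succAbove_eq hne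
    have h3 := DFunLike.congr_fun h m
    rw [face_apply, face_apply, hm] at h3
    have h4 := congrArg (fun z => (z.1 : ℕ)) h3
    have h5 := congrArg (fun z => (z.2 : ℕ)) h3
    simp only [← xs_val, ← ys_val] at h4 h5
    exact ⟨h4, h5⟩
  have k1 := key i (by omega) (by omega)
  have k2 := key (i + 2) (by omega) (by omega)
  refine ext_coords (fun k hk => ?_) (fun k hk => ?_)
  · by_cases hki : k = i + 1
    · rw [hki, ← hb.2.1, ← hb'.2.1, k1.1]
    · exact (key k hk hki).1
  · by_cases hki : k = i + 1
    · rw [hki, hb.2.2.2.2, hb'.2.2.2.2, k2.2]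
    · exact (key k hk hki).2

lemma Paired.left_unique {π₁ π₂ : LPath n p q} {π' : LPath (n + 1) p q} (h₁ : π₁.Paired π')
    (h₂ : π₂.Paired π') : π₁ = π₂ := by
  obtain ⟨i, hb, hq, rfl⟩ := (paired_iff _ _).1 h₁
  obtain ⟨j, hb', hq', rfl⟩ := (paired_iff _ _).1 h₂
  rcases lt_trichotomy i j with hij | rfl | hij
  · exact absurd hb' (hq j hij j.2).2
  · rfl
  · exact absurd hb (hq' i hij i.2).2

/-- The sum of the heights `x + (n - y)` of the vertices of a path; in a prism, it decreases along
the paths of the Eilenberg-Zilber vector field. -/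
def weight (m : ℕ) (π : LPath n p q) : ℕ := ∑ i, ((π i).1 + (m - (π i).2) : ℕ)

/-- The bound allows a lexicographic order with the weight in second place to be encoded by one
natural number. -/
lemma weight_le {m : ℕ} (π : LPath n p q) (hp : p ≤ m) : π.weight m ≤ (n + 1) * (2 * m) := by
  have : ∀ i ∈ (Finset.univ : Finset (Fin (n + 1))), ((π i).1 + (m - (π i).2) : ℕ) ≤ 2 * m :=
    fun i _ => by have := (π i).1.2; omega
  simpa [weight] using Finset.sum_le_card_nsmul _ _ _ this

lemma Paired.weight_lt {m : ℕ} (hm : q ≤ m) {π : LPath n p q} {π' : LPath (n + 1) p q}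
    (h : π.Paired π') (h' : π'.IsInterior) {w : Fin (n + 2)} (hw : (π'.face w).IsInterior)
    (hd : (π'.face w).EndsDiag) (hne : π'.face w ≠ π) : (π'.face w).weight m < π.weight m := by
  obtain ⟨i, hb, hq, rfl⟩ := (paired_iff _ _).1 h
  rw [isInterior_iff] at h' hw
  obtain ⟨j, hj, hd, hq'⟩ := hd
  have hsx := fun k (hk : k ≤ n) => xs_face π' w hk
  have hsy := fun k (hk : k ≤ n) => ys_face π' w hk
  have key := h'.descent hb hq (w := w) (by omega)
    (fun h => hne (by rw [show w = i.succ from Fin.ext h]))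
    (hw.congr (fun k hk => (hsx k hk).symm) (fun k hk => (hsy k hk).symm)) hj
    ((diagAt_congr hsx hsy hj).1 hd) ((quietAfter_congr hsx hsy j).1 hq')
  -- The weight of the whole path is that of a face plus the height of the omitted vertex, so
  -- comparing faces amounts to comparing omitted vertices in the opposite order.
  have e : ∀ v : Fin (n + 2), π'.weight m = ((π' v).1 + (m - (π' v).2) : ℕ) +
      (π'.face v).weight m := fun v => Fin.sum_univ_succAbove _ v
  have e1 := e w
  have e2 := e i.succ
  have h1 := xs_val π' w
  have h2 := ys_val π' w
  have h3 := xs_val π' i.succ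
  have h4 := ys_val π' i.succ
  have h5 := (π' w).2.2
  have h6 := (π' i.succ).2.2
  simp only [Fin.val_succ] at h3 h4
  omega

lemma xs_last (h : p + q = n) {k : ℕ} (hk : k ≤ n) : (last h).xs k = min k p :=
  congrArg (fun k => min k p) (min_eq_left hk)

lemma ys_last (h : p + q = n) {k : ℕ} (hk : k ≤ n) : (last h).ys k = k - p :=
  congrArg (fun k => k - p) (min_eq_left hk)

lemma Quiet.eq_last {π : LPath n p q} (hπ : π.IsInterior) (h : π.Quiet) :
    ∃ hpq : p + q = n, π = last hpq := by
  obtain ⟨h1, h2⟩ := ((isInterior_iff π).1 hπ).eq_of_quiet h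
  refine ⟨h1, ext_coords (fun k hk => ?_) (fun k hk => ?_)⟩
  · rw [(h2 k hk).1, xs_last h1 hk]
  · rw [(h2 k hk).2, ys_last h1 hk]

lemma last_isInterior (h : p + q = n) : (last h).IsInterior := by
  rw [isInterior_iff]
  refine IsWalk.congr (X := fun k => min k p) (Y := fun k => k - p) (fun k hk => xs_last h hk)
    (fun k hk => ys_last h hk) ⟨by simp, ⟨?_, ?_⟩, fun k hk => ?_⟩
  all_goals omega

lemma last_quiet (h : p + q = n) : (last h).Quiet := by
  intro j hj
  rw [diagAt_congr (X := fun k => min k p) (Y := fun k => k - p) (fun k hk => xs_last h hk)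
    (fun k hk => ys_last h hk) hj, bendAt_congr (X := fun k => min k p) (Y := fun k => k - p)
    (fun k hk => xs_last h hk) (fun k hk => ys_last h hk)]
  simp only [DiagAt, BendAt]
  omega

/-! ### Images of paths -/

/-- The image of a path under two monotone maps. -/
def map {p' q' : ℕ} (s : Fin (p + 1) →o Fin (p' + 1)) (t : Fin (q + 1) →o Fin (q' + 1))
    (π : LPath n p q) : LPath n p' q' where
  toFun i := (s (π i).1, t (π i).2)
  monotone' _ _ hij := ⟨s.monotone (π.monotone hij).1, t.monotone (π.monotone hij).2⟩

variable {p' q' : ℕ} {s : Fin (p + 1) →o Fin (p' + 1)} {t : Fin (q + 1) →o Fin (q' + 1)}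
  {π : LPath n p q}

lemma map_isInterior (hs : Function.Surjective s) (ht : Function.Surjective t) (hπ : π.IsInterior)
    (h : Function.Injective (π.map s t)) : (π.map s t).IsInterior :=
  ⟨(π.map s t).monotone.strictMono_of_injective h, hs.comp hπ.2.1, ht.comp hπ.2.2⟩

lemma map_coords (s : Fin (p + 1) →o Fin (p' + 1)) (t : Fin (q + 1) →o Fin (q' + 1))
    (π : LPath n p q) (k : ℕ) :
    (π.xs k = π.xs (k + 1) → (π.map s t).xs k = (π.map s t).xs (k + 1)) ∧
      (π.ys k = π.ys (k + 1) → (π.map s t).ys k = (π.map s t).ys (k + 1)) :=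
  ⟨fun h => congrArg (fun z => (s z : ℕ)) (Fin.ext h),
    fun h => congrArg (fun z => (t z : ℕ)) (Fin.ext h)⟩

section

variable (hπ : π.IsInterior) (hm : (π.map s t).IsInterior)
include hπ hm

omit hm in
lemma diagAt_of_map {k : ℕ} (hk : k < n) (hd : DiagAt (π.map s t).xs (π.map s t).ys k) :
    DiagAt π.xs π.ys k := by
  have h1 := ((isInterior_iff π).1 hπ).step k hk
  have h3 := map_coords s t π k
  simp only [DiagAt] at hd ⊢
  constructor
  · by_contra h
    have := h3.1 (by omega)
    omega
  · by_contra h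
    have := h3.2 (by omega)
    omega

/-- A non-diagonal step moves exactly one coordinate. Its image cannot move the other coordinate,
and must move since the image path is interior; so it has the same type. -/
lemma bendAt_iff_map {k : ℕ} (hk : ¬ DiagAt π.xs π.ys k)
    (hk' : k + 1 < n → ¬ DiagAt π.xs π.ys (k + 1)) :
    BendAt (π.map s t).xs (π.map s t).ys n k ↔ BendAt π.xs π.ys n k := by
  refine and_congr_right fun hkn => ?_
  have hk' := hk' hkn
  have h1 := ((isInterior_iff π).1 hπ).step k (by omega)
  have h2 := ((isInterior_iff π).1 hπ).step (k + 1) (by omega)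
  have h1' := ((isInterior_iff _).1 hm).step k (by omega)
  have h2' := ((isInterior_iff _).1 hm).step (k + 1) (by omega)
  have h3 := map_coords s t π k
  have h4 := map_coords s t π (k + 1)
  simp only [DiagAt, show k + 1 + 1 = k + 2 from rfl] at *
  omega

lemma quietAfter_map {i : ℕ} (hq : QuietAfter π.xs π.ys n i) :
    QuietAfter (π.map s t).xs (π.map s t).ys n i := by
  intro j hij hj
  have h1 := hq j hij hj
  refine ⟨fun h => h1.1 (diagAt_of_map hπ hj h), ?_⟩
  rw [bendAt_iff_map hπ hm h1.1 fun hj' => (hq (j + 1) (by omega) hj').1]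
  exact h1.2

lemma Quiet.map (hq : π.Quiet) : (π.map s t).Quiet := by
  intro j hj
  have h1 := hq j hj
  refine ⟨fun h => h1.1 (diagAt_of_map hπ hj h), ?_⟩
  rw [bendAt_iff_map hπ hm h1.1 fun hj' => (hq (j + 1) hj').1]
  exact h1.2

end

/-- The last bend consists of two non-diagonal steps, hence survives, and no event is created after
it. Taking faces commutes with `map` by definition. Only the image of the larger path is assumed
interior: the smaller one may end with a diagonal. -/
lemma Paired.map {ρ : LPath n p q} {π : LPath (n + 1) p q} (h : ρ.Paired π) (hπ : π.IsInterior)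
    (hm : (π.map s t).IsInterior) : (ρ.map s t).Paired (π.map s t) := by
  obtain ⟨i, hb, hq, rfl⟩ := (paired_iff _ _).1 h
  refine (paired_iff _ _).2 ⟨i, ?_, quietAfter_map hπ hm hq, rfl⟩
  rw [bendAt_iff_map hπ hm (fun h => h.1.ne hb.2.1) fun _ h => h.2.ne hb.2.2.2.2]
  exact hb

end LPath

variable {X Y X' Y' : SSet.{u}} {n p q p' q' : ℕ}

/-! ### Prisms -/

/-- Composing with a section of `α'` exhibits `σ'` as `σ` pulled back along some operator, which
must be mono because `σ'` is non-degenerate. -/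
lemma le_of_map_eq_map {σ : X _⦋p⦌} {σ' : X.nonDegenerate p'} {α : ⦋n⦌ ⟶ ⦋p⦌} {α' : ⦋n⦌ ⟶ ⦋p'⦌}
    [Epi α'] (h : X.map α.op σ = X.map α'.op σ'.1) : p' ≤ p := by
  obtain ⟨⟨s⟩⟩ := isSplitEpi_of_epi α'
  have h1 : X.map (s.section_ ≫ α).op σ = σ'.1 := by
    rw [op_comp, Functor.map_comp, comp_apply, h, ← comp_apply, ← Functor.map_comp, ← op_comp,
      s.id, op_id, CategoryTheory.Functor.map_id, id_apply]
  have := X.mono_of_nonDegenerate σ' _ _ h1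
  exact SimplexCategory.le_of_mono (s.section_ ≫ α)

lemma epi_mkHom {f : Fin (n + 1) →o Fin (p + 1)} (hf : Function.Surjective f) :
    Epi (SimplexCategory.mkHom f) :=
  SimplexCategory.epi_iff_surjective.2 hf

lemma mkHom_injective {f g : Fin (n + 1) →o Fin (p + 1)}
    (h : SimplexCategory.mkHom f = SimplexCategory.mkHom g) : f = g :=
  congrArg SimplexCategory.Hom.toOrderHom h

lemma map_prismSimplex {m : ℕ} (σ : X _⦋p⦌) (τ : Y _⦋q⦌) (π : LPath n p q)
    (θ : Fin (m + 1) →o Fin (n + 1)) :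
    (X ⊗ Y).map (SimplexCategory.mkHom θ).op (prismSimplex σ τ π) =
      prismSimplex σ τ (π.comp θ) := by
  refine Prod.ext ?_ ?_
  · change X.map _ (X.map _ σ) = X.map _ σ
    rw [← comp_apply, ← Functor.map_comp, ← op_comp]
    rfl
  · change Y.map _ (Y.map _ τ) = Y.map _ τ
    rw [← comp_apply, ← Functor.map_comp, ← op_comp]
    rfl

lemma δ_prismSimplex (σ : X _⦋p⦌) (τ : Y _⦋q⦌) (π : LPath (n + 1) p q) (v : Fin (n + 2)) :
    (X ⊗ Y).δ v (prismSimplex σ τ π) = prismSimplex σ τ (π.face v) :=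
  map_prismSimplex σ τ π _

lemma prismSimplex_map (σ : X _⦋p'⦌) (τ : Y _⦋q'⦌) (s : Fin (p + 1) →o Fin (p' + 1))
    (t : Fin (q + 1) →o Fin (q' + 1)) (π : LPath n p q) :
    prismSimplex (X.map (SimplexCategory.mkHom s).op σ) (Y.map (SimplexCategory.mkHom t).op τ) π =
      prismSimplex σ τ (π.map s t) := by
  refine Prod.ext ?_ ?_
  · change X.map _ (X.map _ σ) = X.map _ σ
    rw [← comp_apply, ← Functor.map_comp, ← op_comp]
    rfl
  · change Y.map _ (Y.map _ τ) = Y.map _ τ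
    rw [← comp_apply, ← Functor.map_comp, ← op_comp]
    rfl

lemma tensorHom_prismSimplex (φ : X ⟶ X') (ψ : Y ⟶ Y') (σ : X _⦋p⦌) (τ : Y _⦋q⦌)
    (π : LPath n p q) : (φ ⊗ₘ ψ).app _ (prismSimplex σ τ π) =
      prismSimplex (φ.app _ σ) (ψ.app _ τ) π :=
  (SSet.tensorHom_app_apply φ ψ _).trans (Prod.ext
    (NatTrans.naturality_apply φ (SimplexCategory.mkHom (OrderHom.fst.comp π)).op σ)
    (NatTrans.naturality_apply ψ (SimplexCategory.mkHom (OrderHom.snd.comp π)).op τ))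

/-- Applied in both directions, it shows that the dimensions of a prism are determined by the
simplex. In one direction, with an arbitrary left path, it shows that faces lie in prisms that are
no larger. -/
lemma prismSimplex_le {σ : X _⦋p⦌} {τ : Y _⦋q⦌} {π : LPath n p q} {σ' : X.nonDegenerate p'}
    {τ' : Y.nonDegenerate q'} {π' : LPath n p' q'} (hπ' : π'.IsInterior)
    (h : prismSimplex σ τ π = prismSimplex σ'.1 τ'.1 π') : p' ≤ p ∧ q' ≤ q := by
  have h1 := epi_mkHom (f := OrderHom.fst.comp π') hπ'.2.1
  have h2 := epi_mkHom (f := OrderHom.snd.comp π') hπ'.2.2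
  exact ⟨le_of_map_eq_map (congrArg Prod.fst h), le_of_map_eq_map (congrArg Prod.snd h)⟩

lemma prismSimplex_injective {σ σ' : X.nonDegenerate p} {τ τ' : Y.nonDegenerate q}
    {π π' : LPath n p q} (hπ' : π'.IsInterior)
    (h : prismSimplex σ.1 τ.1 π = prismSimplex σ'.1 τ'.1 π') : σ = σ' ∧ τ = τ' ∧ π = π' := by
  have h1 := epi_mkHom (f := OrderHom.fst.comp π') hπ'.2.1
  have h2 := epi_mkHom (f := OrderHom.snd.comp π') hπ'.2.2
  have hx := congrArg Prod.fst h
  have hy := congrArg Prod.snd h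
  refine ⟨(X.unique_nonDegenerate_simplex _ _ σ' hx _ σ rfl).symm,
    (Y.unique_nonDegenerate_simplex _ _ τ' hy _ τ rfl).symm, ?_⟩
  have e1 := mkHom_injective (X.unique_nonDegenerate_map _ _ σ' hx _ σ rfl)
  have e2 := mkHom_injective (Y.unique_nonDegenerate_map _ _ τ' hy _ τ rfl)
  exact OrderHom.ext _ _ (funext fun i => Prod.ext (DFunLike.congr_fun e1 i).symm
    (DFunLike.congr_fun e2 i).symm)

lemma injective_of_prismSimplex_mem {σ : X _⦋p⦌} {τ : Y _⦋q⦌} {π : LPath n p q}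
    (h : prismSimplex σ τ π ∈ (X ⊗ Y).nonDegenerate n) : Function.Injective π := by
  have key : ∀ a b, a < b → π a ≠ π b := by
    intro a b hab heq
    -- Between two equal vertices a monotone path is constant, so collapsing the interval `[a, b]`
    -- to `a` fixes the simplex; non-degeneracy would make this collapse injective.
    let θ : Fin (n + 1) →o Fin (n + 1) := ⟨fun k => if a ≤ k ∧ k ≤ b then a else k, by
      intro k l hkl
      simp only
      split_ifs <;> omega⟩
    have hθ : π.comp θ = π := by
      refine OrderHom.ext _ _ (funext fun k => ?_)
      change π (if a ≤ k ∧ k ≤ b then a else k) = π k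
      split_ifs with hk
      · exact le_antisymm (π.monotone hk.1) (heq ▸ π.monotone hk.2)
      · rfl
    have hm := SSet.mono_of_nonDegenerate _ ⟨_, h⟩ (SimplexCategory.mkHom θ) (prismSimplex σ τ π)
      (by rw [map_prismSimplex, hθ])
    have hinj : Function.Injective θ := SimplexCategory.mono_iff_injective.1 hm
    refine hab.ne (hinj ?_)
    change (if a ≤ a ∧ a ≤ b then a else a) = if a ≤ b ∧ b ≤ b then a else b
    simp [hab.le]
  intro a b hab
  rcases lt_trichotomy a b with h1 | h1 | h1
  · exact absurd hab (key a b h1)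
  · exact h1
  · exact absurd hab.symm (key b a h1)

/-- Reducing `z` to a non-degenerate simplex gives another decomposition of `x`. By uniqueness in
the Eilenberg-Zilber lemma it is the given one, so `α` factors through `θ`. -/
lemma exists_eq_comp_of_epi {x : X _⦋n⦌} {σ : X.nonDegenerate p} {α : ⦋n⦌ ⟶ ⦋p⦌} [Epi α]
    (hx : X.map α.op σ.1 = x) {m : ℕ} {θ : ⦋n⦌ ⟶ ⦋m⦌} [Epi θ] {z : X _⦋m⦌}
    (hz : X.map θ.op z = x) : ∃ β : ⦋m⦌ ⟶ ⦋p⦌, α = θ ≫ β := by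
  obtain ⟨r, β, _, y, rfl⟩ := X.exists_nonDegenerate z
  have h : x = X.map (θ ≫ β).op y.1 := by
    rw [← hz, op_comp, Functor.map_comp, comp_apply]
  obtain rfl := X.unique_nonDegenerate_dim x α σ hx.symm (θ ≫ β) y h
  exact ⟨β, X.unique_nonDegenerate_map x α σ hx.symm (θ ≫ β) y h⟩

/-- A degeneracy common to both components would factor both projections of `π`. These are jointly
injective, so it would be injective, which is impossible onto a smaller dimension. -/
lemma prismSimplex_mem (σ : X.nonDegenerate p) (τ : Y.nonDegenerate q) {π : LPath n p q}
    (hπ : π.IsInterior) : prismSimplex σ.1 τ.1 π ∈ (X ⊗ Y).nonDegenerate n := by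
  have h1 := epi_mkHom (f := OrderHom.fst.comp π) hπ.2.1
  have h2 := epi_mkHom (f := OrderHom.snd.comp π) hπ.2.2
  rw [SSet.mem_nonDegenerate_iff_notMem_degenerate, SSet.mem_degenerate_iff]
  rintro ⟨m, hm, θ, _, z, hz⟩
  obtain ⟨β, hβ⟩ := exists_eq_comp_of_epi (x := (prismSimplex σ.1 τ.1 π).1) (σ := σ) (by rfl)
    (congrArg Prod.fst hz)
  obtain ⟨γ, hγ⟩ := exists_eq_comp_of_epi (x := (prismSimplex σ.1 τ.1 π).2) (σ := τ) (by rfl)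
    (congrArg Prod.snd hz)
  have hinj : Function.Injective θ.toOrderHom := by
    intro a b hab
    refine hπ.1.injective (Prod.ext ?_ ?_)
    · have e := fun i => SimplexCategory.congr_toOrderHom_apply hβ i
      exact (e a).trans ((congrArg β.toOrderHom hab).trans (e b).symm)
    · have e := fun i => SimplexCategory.congr_toOrderHom_apply hγ i
      exact (e a).trans ((congrArg γ.toOrderHom hab).trans (e b).symm)
  have := Fintype.card_le_of_injective _ hinj
  simp at this
  omega

lemma exists_prismSimplex (z : (X ⊗ Y).nonDegenerate n) :
    ∃ (p q : ℕ) (σ : X.nonDegenerate p) (τ : Y.nonDegenerate q) (π : LPath n p q),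
      π.IsInterior ∧ z.1 = prismSimplex σ.1 τ.1 π := by
  obtain ⟨p, α, hα, σ, hσ⟩ := X.exists_nonDegenerate z.1.1
  obtain ⟨q, β, hβ, τ, hτ⟩ := Y.exists_nonDegenerate z.1.2
  rw [SimplexCategory.epi_iff_surjective] at hα hβ
  let π : LPath n p q := α.toOrderHom.prod β.toOrderHom
  have hz : z.1 = prismSimplex σ.1 τ.1 π := by
    have h1 : SimplexCategory.mkHom (OrderHom.fst.comp π) = α := by ext; rfl
    have h2 : SimplexCategory.mkHom (OrderHom.snd.comp π) = β := by ext; rfl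
    refine Prod.ext ?_ ?_
    · rw [hσ, ← h1]; rfl
    · rw [hτ, ← h2]; rfl
  refine ⟨p, q, σ, τ, π, ⟨?_, hα, hβ⟩, hz⟩
  exact π.monotone.strictMono_of_injective (injective_of_prismSimplex_mem (hz ▸ z.2))

/-! ### The cells of the Eilenberg-Zilber vector field -/

/-- Since the prism and the path are determined by the simplex, the existential in `ezField` can be
read in any chosen presentation. -/
lemma ezField_left_iff {ρ : (X ⊗ Y).nonDegenerate n} {σ : X.nonDegenerate p}
    {τ : Y.nonDegenerate q} {π : LPath n p q} (hπ : π.IsInterior)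
    (hρ : ρ.1 = prismSimplex σ.1 τ.1 π) (ρ' : (X ⊗ Y).nonDegenerate (n + 1)) :
    ezField X Y n ρ ρ' ↔
      ∃ π', π'.IsInterior ∧ π.Paired π' ∧ ρ'.1 = prismSimplex σ.1 τ.1 π' := by
  constructor
  · rintro ⟨p₁, q₁, σ₁, τ₁, π₁, π', h1, h2, h3, h4, h5⟩
    rw [hρ] at h4
    have hle := prismSimplex_le h1 h4
    have hle' := prismSimplex_le hπ h4.symm
    obtain rfl := le_antisymm hle.1 hle'.1
    obtain rfl := le_antisymm hle.2 hle'.2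
    obtain ⟨rfl, rfl, rfl⟩ := prismSimplex_injective h1 h4
    exact ⟨π', h2, h3, h5⟩
  · rintro ⟨π', h2, h3, h5⟩
    exact ⟨p, q, σ, τ, π, π', hπ, h2, h3, hρ, h5⟩

lemma ezField_right_iff {ρ' : (X ⊗ Y).nonDegenerate (n + 1)} {σ : X.nonDegenerate p}
    {τ : Y.nonDegenerate q} {π' : LPath (n + 1) p q} (hπ' : π'.IsInterior)
    (hρ' : ρ'.1 = prismSimplex σ.1 τ.1 π') (ρ : (X ⊗ Y).nonDegenerate n) :
    ezField X Y n ρ ρ' ↔ ∃ π, π.Paired π' ∧ ρ.1 = prismSimplex σ.1 τ.1 π := by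
  constructor
  · rintro ⟨p₁, q₁, σ₁, τ₁, π₁, π', h1, h2, h3, h4, h5⟩
    rw [hρ'] at h5
    have hle := prismSimplex_le h2 h5
    have hle' := prismSimplex_le hπ' h5.symm
    obtain rfl := le_antisymm hle.1 hle'.1
    obtain rfl := le_antisymm hle.2 hle'.2
    obtain ⟨rfl, rfl, rfl⟩ := prismSimplex_injective h2 h5
    exact ⟨π₁, h3, h4⟩
  · rintro ⟨π, h3, h5⟩
    exact ⟨p, q, σ, τ, π, π', h3.isInterior hπ', hπ', h3, h5, hρ'⟩

section

variable {c : (X ⊗ Y).nonDegenerate n} {σ : X.nonDegenerate p} {τ : Y.nonDegenerate q}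
  {π : LPath n p q} (hπ : π.IsInterior) (hc : c.1 = prismSimplex σ.1 τ.1 π)
include hπ hc

lemma isSource_iff : CellComplex.IsSource (ezField X Y) c ↔ π.EndsDiag := by
  constructor
  · rintro ⟨ρ', h⟩
    obtain ⟨π', -, h, -⟩ := (ezField_left_iff hπ hc ρ').1 h
    exact h.endsDiag
  · intro h
    obtain ⟨π', h1, h2⟩ := h.exists_paired hπ
    exact ⟨⟨_, prismSimplex_mem σ τ h1⟩, (ezField_left_iff hπ hc _).2 ⟨π', h1, h2, rfl⟩⟩

lemma isTarget_iff : CellComplex.IsTarget (ezField X Y) c ↔ π.EndsBend := by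
  cases n with
  | zero => exact ⟨fun h => h.elim, fun ⟨i, hi, _⟩ => absurd hi (Nat.not_lt_zero i)⟩
  | succ n =>
    constructor
    · rintro ⟨ρ, h⟩
      obtain ⟨π', h, -⟩ := (ezField_right_iff hπ hc ρ).1 h
      exact h.endsBend
    · intro h
      obtain ⟨π₁, h1⟩ := h.exists_paired
      exact ⟨⟨_, prismSimplex_mem σ τ (h1.isInterior hπ)⟩,
        (ezField_right_iff hπ hc _).2 ⟨π₁, h1, rfl⟩⟩

lemma isCritical_iff : CellComplex.IsCritical (ezField X Y) c ↔ π.Quiet := by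
  rw [CellComplex.IsCritical, isSource_iff hπ hc, isTarget_iff hπ hc]
  constructor
  · rintro ⟨h1, h2⟩
    rcases π.endsDiag_or with h | h | h
    · exact absurd h h1
    · exact absurd h h2
    · exact h
  · exact fun h => ⟨h.not_endsDiag, h.not_endsBend⟩

end

lemma cell_of_mem {x : X _⦋n⦌} (hx : x ∈ X.nonDegenerate n) :
    cell X x = Finsupp.single ⟨x, hx⟩ 1 := dif_pos hx

lemma cell_val (x : X.nonDegenerate n) : cell X x.1 = Finsupp.single x 1 := cell_of_mem x.2

lemma cell_apply_of_eq {x : X _⦋n⦌} {y : X.nonDegenerate n} (h : x = y.1) : cell X x y = 1 := by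
  subst h
  rw [cell_val, Finsupp.single_eq_same]

lemma cell_apply_of_ne {x : X _⦋n⦌} {y : X.nonDegenerate n} (h : x ≠ y.1) : cell X x y = 0 := by
  classical
  by_cases hx : x ∈ X.nonDegenerate n
  · rw [cell_of_mem hx, Finsupp.single_apply, if_neg]
    rintro rfl
    exact h rfl
  · rw [cell_of_degenerate X x (by rwa [SSet.mem_degenerate_iff_notMem_nonDegenerate])]
    rfl

lemma incidence_normalized (ρ : X.nonDegenerate n) (ρ' : X.nonDegenerate (n + 1)) :
    (normalized X).incidence ρ ρ' =
      ∑ i : Fin (n + 2), (-1 : ℤ) ^ (i : ℕ) * cell X (X.δ i ρ'.1) ρ := by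
  have : (normalized X).incidence ρ ρ' = normD X n (Finsupp.single ρ' 1) ρ := rfl
  rw [this, ← cell_val, normD_cell, Finsupp.finsetSum_apply]
  rfl

lemma exists_face_of_incidence_ne_zero {ρ : X.nonDegenerate n} {ρ' : X.nonDegenerate (n + 1)}
    (h : (normalized X).incidence ρ ρ' ≠ 0) : ∃ i, X.δ i ρ'.1 = ρ.1 := by
  by_contra! hne
  refine h ?_
  rw [incidence_normalized]
  exact Finset.sum_eq_zero fun i _ => by rw [cell_apply_of_ne (hne i), mul_zero]

lemma isVectorField_ezField (X Y : SSet.{u}) : CellComplex.IsVectorField (ezField X Y) where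
  regular n ρ ρ' := by
    rintro ⟨p, q, σ, τ, π, π', h1, h2, h3, h4, h5⟩
    obtain ⟨i, hb, hq, rfl⟩ := (LPath.paired_iff _ _).1 h3
    -- Distinct faces of an interior path give distinct simplices, so exactly one term of the
    -- alternating sum contributes.
    rw [incidence_normalized, Finset.sum_eq_single i.succ]
    · rw [cell_apply_of_eq (by rw [h5, h4, δ_prismSimplex])]
      simp
    · intro v _ hv
      rw [cell_apply_of_ne, mul_zero]
      intro h
      rw [h5, h4, δ_prismSimplex] at h
      exact hv (h2.face_injective (prismSimplex_injective h1 h).2.2)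
    · simp
  target_unique n ρ ρ₁ ρ₂ := by
    rintro ⟨p, q, σ, τ, π, π', h1, h2, h3, h4, h5⟩ h
    obtain ⟨π₂, -, h6, h7⟩ := (ezField_left_iff h1 h4 ρ₂).1 h
    exact Subtype.ext (by rw [h5, h7, h3.right_unique h6])
  source_unique n ρ₁ ρ₂ ρ' := by
    rintro ⟨p, q, σ, τ, π, π', h1, h2, h3, h4, h5⟩ h
    obtain ⟨π₂, h6, h7⟩ := (ezField_right_iff h2 h5 ρ₂).1 h
    exact Subtype.ext (by rw [h4, h7, h3.left_unique h6])
  disjoint n c := by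
    obtain ⟨p, q, σ, τ, π, hπ, hc⟩ := exists_prismSimplex c
    rw [isSource_iff hπ hc, isTarget_iff hπ hc]
    exact fun h => h.1.not_endsBend h.2

/-- The rank of a simplex of path `π` in a prism of dimension `p + q`: the dimension of the prism
and the weight of the path, in the lexicographic order. -/
noncomputable def ezRank (X Y : SSet.{u}) (n : ℕ) (c : (X ⊗ Y).nonDegenerate n) : ℕ :=
  sInf {r | ∃ (p q : ℕ) (σ : X.nonDegenerate p) (τ : Y.nonDegenerate q) (π : LPath n p q),
    π.IsInterior ∧ c.1 = prismSimplex σ.1 τ.1 π ∧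
      r = (p + q) * ((n + 1) * (2 * n) + 1) + π.weight n}

lemma ezRank_eq {c : (X ⊗ Y).nonDegenerate n} {σ : X.nonDegenerate p} {τ : Y.nonDegenerate q}
    {π : LPath n p q} (hπ : π.IsInterior) (hc : c.1 = prismSimplex σ.1 τ.1 π) :
    ezRank X Y n c = (p + q) * ((n + 1) * (2 * n) + 1) + π.weight n := by
  -- By uniqueness of the prism and path, the set of candidate ranks is a singleton.
  refine Eq.trans (congrArg sInf (Set.ext fun r => ?_)) (csInf_singleton _)
  constructor
  · rintro ⟨p₁, q₁, σ₁, τ₁, π₁, h1, h4, rfl⟩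
    rw [hc] at h4
    have hle := prismSimplex_le h1 h4
    have hle' := prismSimplex_le hπ h4.symm
    obtain rfl := le_antisymm hle.1 hle'.1
    obtain rfl := le_antisymm hle.2 hle'.2
    obtain ⟨rfl, rfl, rfl⟩ := prismSimplex_injective h1 h4
    rfl
  · rintro rfl
    exact ⟨p, q, σ, τ, π, hπ, hc, rfl⟩

lemma LPath.IsInterior.le {π : LPath n p q} (hπ : π.IsInterior) : p ≤ n ∧ q ≤ n := by
  have h1 := Fintype.card_le_of_surjective _ hπ.2.1
  have h2 := Fintype.card_le_of_surjective _ hπ.2.2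
  simp only [Fintype.card_fin] at h1 h2
  omega

/-- A source face either stays in the same prism, where the weight drops, or lies in one of smaller
total dimension. In the latter case the factor `(n + 1) * (2 * n) + 1`, larger than any weight,
makes the dimension decide. -/
lemma isRank_ezRank (X Y : SSet.{u}) : CellComplex.IsRank (ezField X Y) (ezRank X Y) := by
  rintro n ρ ρ₂ ρ' ⟨p, q, σ, τ, π, π', h1, h2, h3, h4, h5⟩ hs hi hne
  obtain ⟨v, hv⟩ := exists_face_of_incidence_ne_zero hi
  obtain ⟨p₂, q₂, σ₂, τ₂, π₂, hπ₂, h6⟩ := exists_prismSimplex ρ₂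
  have hd := (isSource_iff hπ₂ h6).1 hs
  rw [h5, δ_prismSimplex, h6] at hv
  obtain ⟨hp, hq⟩ := prismSimplex_le hπ₂ hv
  rw [ezRank_eq hπ₂ h6, ezRank_eq h1 h4]
  by_cases hpq : p₂ = p ∧ q₂ = q
  · obtain ⟨rfl, rfl⟩ := hpq
    obtain ⟨rfl, rfl, rfl⟩ := prismSimplex_injective hπ₂ hv
    refine Nat.add_lt_add_left (h3.weight_lt h1.le.2 h2 hπ₂ hd fun h => hne ?_) _
    exact Subtype.ext (by rw [h6, h4, h])
  · have hlt : p₂ + q₂ + 1 ≤ p + q := by omega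
    have h7 := LPath.weight_le π₂ hπ₂.le.1
    have h8 := Nat.mul_le_mul_right ((n + 1) * (2 * n) + 1) hlt
    rw [add_mul, one_mul] at h8
    omega

lemma bijective_dTargetSource (X Y : SSet.{u}) (n : ℕ) :
    Function.Bijective (CellComplex.dTargetSource (ezField X Y) n) :=
  ⟨(isRank_ezRank X Y).injective (isVectorField_ezField X Y) n,
    (isRank_ezRank X Y).surjective (isVectorField_ezField X Y) n⟩

variable {X Y X' Y' X'' Y'' : SSet.{u}} {n p q : ℕ}

/-! ### Induced maps -/

lemma normMap_cell (φ : X ⟶ X') (x : X _⦋n⦌) : normMap φ n (cell X x) = cell X' (φ.app _ x) := by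
  by_cases hx : x ∈ X.nonDegenerate n
  · rw [cell_of_mem hx, normMap, Finsupp.linearCombination_single, one_smul]
  · rw [← SSet.mem_degenerate_iff_notMem_nonDegenerate] at hx
    rw [cell_of_degenerate X x hx, map_zero,
      cell_of_degenerate X' _ (SSet.degenerate_app_apply hx φ)]

lemma chains_ext {M : Type*} [AddCommMonoid M] [Module ℤ M] {f g : NChains X n →ₗ[ℤ] M}
    (h : ∀ x : X.nonDegenerate n, f (cell X x.1) = g (cell X x.1)) : f = g :=
  Finsupp.lhom_ext' fun x => LinearMap.ext_ring (by
    have := h x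
    rw [cell_val] at this
    exact this)

lemma normMap_normD (φ : X ⟶ X') (n : ℕ) :
    normMap φ n ∘ₗ normD X n = normD X' n ∘ₗ normMap φ (n + 1) := by
  refine chains_ext fun x => ?_
  rw [LinearMap.comp_apply, LinearMap.comp_apply, normD_cell, normMap_cell, normD_cell, map_sum]
  refine Finset.sum_congr rfl fun i _ => ?_
  rw [map_zsmul, normMap_cell]
  congr 2
  exact NatTrans.naturality_apply φ (SimplexCategory.δ i).op x.1

lemma normMap_id (X : SSet.{u}) (n : ℕ) : normMap (𝟙 X) n = LinearMap.id :=
  chains_ext fun x => by rw [normMap_cell, LinearMap.id_apply]; rfl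

lemma normMap_comp (φ : X ⟶ X') (φ' : X' ⟶ X'') (n : ℕ) :
    normMap (φ ≫ φ') n = normMap φ' n ∘ₗ normMap φ n :=
  chains_ext fun x => by
    rw [LinearMap.comp_apply, normMap_cell, normMap_cell, normMap_cell]; rfl

lemma tensMap_apply (φ : X ⟶ X') (ψ : Y ⟶ Y') (z : Tens X Y n)
    (pq : {pq : ℕ × ℕ // pq.1 + pq.2 = n}) : tensMap φ ψ n z pq =
      TensorProduct.map (normMap φ pq.1.1) (normMap ψ pq.1.2) (z pq) := rfl

lemma tensMap_id (X Y : SSet.{u}) (n : ℕ) : tensMap (𝟙 X) (𝟙 Y) n = LinearMap.id :=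
  LinearMap.ext fun z => DFinsupp.ext fun pq => by
    rw [tensMap_apply, normMap_id, normMap_id, TensorProduct.map_id]
    rfl

lemma tensMap_comp (φ : X ⟶ X') (ψ : Y ⟶ Y') (φ' : X' ⟶ X'') (ψ' : Y' ⟶ Y'') (n : ℕ) :
    tensMap (φ ≫ φ') (ψ ≫ ψ') n = tensMap φ' ψ' n ∘ₗ tensMap φ ψ n :=
  LinearMap.ext fun z => DFinsupp.ext fun pq => by
    rw [LinearMap.comp_apply, tensMap_apply, tensMap_apply, tensMap_apply, normMap_comp,
      normMap_comp, TensorProduct.map_comp]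
    rfl

/-- The non-degenerate image of a prism is described by the image of the path. -/
lemma exists_image_prism (φ : X ⟶ X') (ψ : Y ⟶ Y') (σ : X _⦋p⦌) (τ : Y _⦋q⦌) :
    ∃ (p' q' : ℕ) (σ' : X'.nonDegenerate p') (τ' : Y'.nonDegenerate q')
      (s : Fin (p + 1) →o Fin (p' + 1)) (t : Fin (q + 1) →o Fin (q' + 1)),
      Function.Surjective s ∧ Function.Surjective t ∧ ∀ (n : ℕ) (π : LPath n p q),
        (φ ⊗ₘ ψ).app _ (prismSimplex σ τ π) = prismSimplex σ'.1 τ'.1 (π.map s t) := by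
  obtain ⟨p', α, hα, σ', hσ⟩ := X'.exists_nonDegenerate (φ.app _ σ)
  obtain ⟨q', β, hβ, τ', hτ⟩ := Y'.exists_nonDegenerate (ψ.app _ τ)
  rw [SimplexCategory.epi_iff_surjective] at hα hβ
  refine ⟨p', q', σ', τ', α.toOrderHom, β.toOrderHom, hα, hβ, fun n π => ?_⟩
  rw [tensorHom_prismSimplex, hσ, hτ]
  exact prismSimplex_map σ'.1 τ'.1 α.toOrderHom β.toOrderHom π

lemma isFieldCompatible (φ : X ⟶ X') (ψ : Y ⟶ Y') : IsFieldCompatible φ ψ where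
  vector n ρ ρ' := by
    rintro ⟨p, q, σ, τ, π, π', h1, h2, h3, h4, h5⟩ hρ'
    obtain ⟨p₁, q₁, σ₁, τ₁, s, t, hs, ht, h6⟩ := exists_image_prism φ ψ σ.1 τ.1
    have e := h6 _ π
    have e' := h6 _ π'
    rw [← h4] at e
    rw [← h5] at e'
    -- Non-degeneracy of the image of `ρ'` is used only through injectivity of the image path; that
    -- of the image of `ρ` then follows from the pairing.
    have hm := LPath.map_isInterior hs ht h2 (injective_of_prismSimplex_mem (e' ▸ hρ'))
    have hp := h3.map h2 hm
    exact ⟨e ▸ prismSimplex_mem σ₁ τ₁ (hp.isInterior hm), p₁, q₁, σ₁, τ₁, _, _,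
      hp.isInterior hm, hm, hp, e, e'⟩
  critical n ρ hρ hρ' := by
    obtain ⟨p, q, σ, τ, π, hπ, h4⟩ := exists_prismSimplex ρ
    obtain ⟨p₁, q₁, σ₁, τ₁, s, t, hs, ht, h6⟩ := exists_image_prism φ ψ σ.1 τ.1
    have e := h6 _ π
    rw [← h4] at e
    have hm := LPath.map_isInterior hs ht hπ (injective_of_prismSimplex_mem (e ▸ hρ'))
    exact (isCritical_iff hm e).2 (((isCritical_iff hπ h4).1 hρ).map hπ hm)

/-- Cells with degenerate image contribute zero, so the condition is needed only where the image is
non-degenerate. -/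
lemma normMap_incl {P : X.nonDegenerate n → Prop} {Q : X'.nonDegenerate n → Prop} (φ : X ⟶ X')
    (h : ∀ x, P x → ∀ hx : φ.app _ x.1 ∈ X'.nonDegenerate n, Q ⟨_, hx⟩)
    (z : {x // P x} →₀ ℤ) :
    normMap φ n (incl P z) = incl Q (proj Q (normMap φ n (incl P z))) := by
  induction z using Finsupp.induction_linear with
  | zero => simp
  | add z w hz hw => simp only [map_add, ← hz, ← hw]
  | single x r =>
    have e : (Finsupp.single x.1 r : NChains X n) = r • cell X x.1.1 := by rw [cell_val]; simp
    rw [incl_single, e, map_zsmul, map_zsmul, map_zsmul, normMap_cell]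
    congr 1
    by_cases hx : φ.app _ x.1.1 ∈ X'.nonDegenerate n
    · rw [cell_of_mem hx, proj_single_of_pos (h x.1 x.2 hx), incl_single]
    · rw [← SSet.mem_degenerate_iff_notMem_nonDegenerate] at hx
      rw [cell_of_degenerate _ _ hx, map_zero, map_zero]

lemma preserves_normMap (φ : X ⟶ X') (ψ : Y ⟶ Y') :
    CellComplex.Preserves (ezField X Y) (ezField X' Y') (normMap (φ ⊗ₘ ψ)) where
  comm n := LinearMap.congr_fun (normMap_normD (φ ⊗ₘ ψ) n)
  target n := normMap_incl _ fun x hx hx' => by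
    cases n with
    | zero => exact hx.elim
    | succ n =>
      obtain ⟨ρ, hρ⟩ := hx
      obtain ⟨h, h'⟩ := (isFieldCompatible φ ψ).vector n ρ x hρ hx'
      exact ⟨_, h'⟩
  critical n := normMap_incl _ fun x hx hx' => (isFieldCompatible φ ψ).critical n x hx hx'

/-! ### The critical chains -/

/-- The cells of the tensor product. -/
abbrev TensCells (X Y : SSet.{u}) (n : ℕ) : Type u :=
  Σ pq : {pq : ℕ × ℕ // pq.1 + pq.2 = n}, X.nonDegenerate pq.1.1 × Y.nonDegenerate pq.1.2

/-- The last simplex of a prism, as a critical cell. -/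
def lastCell (X Y : SSet.{u}) (n : ℕ) (c : TensCells X Y n) :
    {c : (X ⊗ Y).nonDegenerate n // CellComplex.IsCritical (ezField X Y) c} :=
  ⟨⟨_, prismSimplex_mem c.2.1 c.2.2 (LPath.last_isInterior c.1.2)⟩,
    (isCritical_iff (LPath.last_isInterior c.1.2) rfl).2 (LPath.last_quiet c.1.2)⟩

lemma lastCell_bijective (X Y : SSet.{u}) (n : ℕ) : Function.Bijective (lastCell X Y n) := by
  constructor
  · rintro ⟨⟨⟨p, q⟩, hpq⟩, σ, τ⟩ ⟨⟨⟨p', q'⟩, hpq'⟩, σ', τ'⟩ h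
    have h := congrArg (fun z => z.1.1) h
    change prismSimplex σ.1 τ.1 (LPath.last hpq) = prismSimplex σ'.1 τ'.1 (LPath.last hpq') at h
    have hle := prismSimplex_le (LPath.last_isInterior hpq') h
    have hle' := prismSimplex_le (LPath.last_isInterior hpq) h.symm
    simp only at hle hle'
    obtain rfl := le_antisymm hle.1 hle'.1
    obtain rfl := le_antisymm hle.2 hle'.2
    obtain ⟨rfl, rfl, -⟩ := prismSimplex_injective (LPath.last_isInterior hpq') h
    rfl
  · rintro ⟨c, hc⟩
    obtain ⟨p, q, σ, τ, π, hπ, h⟩ := exists_prismSimplex c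
    obtain ⟨hpq, rfl⟩ := ((isCritical_iff hπ h).1 hc).eq_last hπ
    exact ⟨⟨⟨⟨p, q⟩, hpq⟩, σ, τ⟩, Subtype.ext (Subtype.ext h.symm)⟩

/-- The element `x ⊗ y` of the tensor product. -/
noncomputable def tens (pq : {pq : ℕ × ℕ // pq.1 + pq.2 = n}) (x : X _⦋pq.1.1⦌) (y : Y _⦋pq.1.2⦌) :
    Tens X Y n :=
  DirectSum.lof ℤ _ (fun pq : {pq : ℕ × ℕ // pq.1 + pq.2 = n} =>
    NChains X pq.1.1 ⊗[ℤ] NChains Y pq.1.2) pq (cell X x ⊗ₜ cell Y y)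

lemma tens_ext {M : Type*} [AddCommMonoid M] [Module ℤ M] {f g : Tens X Y n →ₗ[ℤ] M}
    (h : ∀ pq (x : X.nonDegenerate _) (y : Y.nonDegenerate _),
      f (tens pq x.1 y.1) = g (tens pq x.1 y.1)) : f = g := by
  refine DirectSum.linearMap_ext ℤ fun pq => TensorProduct.ext ?_
  refine chains_ext fun x => chains_ext fun y => ?_
  exact h pq x y

lemma tensMap_tens (φ : X ⟶ X') (ψ : Y ⟶ Y') (pq : {pq : ℕ × ℕ // pq.1 + pq.2 = n})
    (x : X _⦋pq.1.1⦌) (y : Y _⦋pq.1.2⦌) :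
    tensMap φ ψ n (tens pq x y) = tens pq (φ.app _ x) (ψ.app _ y) := by
  rw [tens, tens, ← normMap_cell, ← normMap_cell]
  exact DirectSum.lmap_lof (R := ℤ) _ _ _

/-- The last path runs along a full horizontal edge and then a full vertical edge of the rectangle,
so its injectivity tests `s` and `t` separately. -/
lemma last_map_injective {p' q' : ℕ} (h : p + q = n) {s : Fin (p + 1) →o Fin (p' + 1)}
    {t : Fin (q + 1) →o Fin (q' + 1)} (hm : Function.Injective ((LPath.last h).map s t)) :
    Function.Injective s ∧ Function.Injective t := by
  constructor
  · have hl : ∀ i : Fin (p + 1), LPath.last h ⟨i, by omega⟩ = (i, 0) := fun i =>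
      Prod.ext (Fin.ext (min_eq_left (Nat.le_of_lt_succ i.2)))
        (Fin.ext (Nat.sub_eq_zero_of_le (Nat.le_of_lt_succ i.2)))
    intro i j hij
    have := @hm ⟨i, by omega⟩ ⟨j, by omega⟩ (by
      change (s (LPath.last h _).1, t (LPath.last h _).2) =
        (s (LPath.last h _).1, t (LPath.last h _).2)
      rw [hl, hl]
      exact Prod.ext hij rfl)
    exact Fin.ext (Fin.mk.inj this)
  · have hl : ∀ i : Fin (q + 1), LPath.last h ⟨p + i, by omega⟩ = (Fin.last p, i) := fun i =>
      Prod.ext (Fin.ext (min_eq_right (Nat.le_add_right p i)))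
        (Fin.ext (Nat.add_sub_cancel_left p i))
    intro i j hij
    have := @hm ⟨p + i, by omega⟩ ⟨p + j, by omega⟩ (by
      change (s (LPath.last h _).1, t (LPath.last h _).2) =
        (s (LPath.last h _).1, t (LPath.last h _).2)
      rw [hl, hl]
      exact Prod.ext rfl hij)
    exact Fin.ext (Nat.add_left_cancel (Fin.mk.inj this))

lemma last_prismSimplex_mem {x : X _⦋p⦌} {y : Y _⦋q⦌} (h : p + q = n)
    (hm : prismSimplex x y (LPath.last h) ∈ (X ⊗ Y).nonDegenerate n) :
    x ∈ X.nonDegenerate p ∧ y ∈ Y.nonDegenerate q := by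
  obtain ⟨p', α, hα, x', rfl⟩ := X.exists_nonDegenerate x
  obtain ⟨q', β, hβ, y', rfl⟩ := Y.exists_nonDegenerate y
  have hm' : prismSimplex x'.1 y'.1 ((LPath.last h).map α.toOrderHom β.toOrderHom) ∈
      (X ⊗ Y).nonDegenerate n := by
    rw [← prismSimplex_map]
    exact hm
  obtain ⟨h1, h2⟩ := last_map_injective h (injective_of_prismSimplex_mem hm')
  have hα' := SimplexCategory.mono_iff_injective.2 h1
  have hβ' := SimplexCategory.mono_iff_injective.2 h2
  obtain rfl := le_antisymm (SimplexCategory.le_of_mono α) (SimplexCategory.le_of_epi α)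
  obtain rfl := le_antisymm (SimplexCategory.le_of_mono β) (SimplexCategory.le_of_epi β)
  obtain rfl := SimplexCategory.eq_id_of_mono α
  obtain rfl := SimplexCategory.eq_id_of_mono β
  simp

/-- The defining formula persists for degenerate `x` or `y`, both sides being zero. Functoriality
needs this, because simplicial maps may send non-degenerate simplices to degenerate ones. -/
lemma critOfTens_tens (pq : {pq : ℕ × ℕ // pq.1 + pq.2 = n})
    (x : X _⦋pq.1.1⦌) (y : Y _⦋pq.1.2⦌) :
    critOfTens X Y n (tens pq x y) = proj (CellComplex.IsCritical (ezField X Y))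
      (cell (X ⊗ Y) (prismSimplex x y (LPath.last pq.2))) := by
  rw [critOfTens, tens, DirectSum.toModule_lof]
  change Finsupp.linearCombination ℤ _ (finsuppTensorFinsupp' ℤ _ _ (cell X x ⊗ₜ cell Y y)) = _
  by_cases hxy : x ∈ X.nonDegenerate _ ∧ y ∈ Y.nonDegenerate _
  · rw [cell_of_mem hxy.1, cell_of_mem hxy.2]
    rw [finsuppTensorFinsupp'_single_tmul_single, mul_one,
      Finsupp.linearCombination_single, one_smul]
  · have h0 : cell X x ⊗ₜ[ℤ] cell Y y = 0 := by
      by_cases hx : x ∈ X.nonDegenerate _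
      · rw [cell_of_degenerate Y y (by
          rw [SSet.mem_degenerate_iff_notMem_nonDegenerate]; exact fun hy => hxy ⟨hx, hy⟩),
          TensorProduct.tmul_zero]
      · rw [cell_of_degenerate X x (by rwa [SSet.mem_degenerate_iff_notMem_nonDegenerate]),
          TensorProduct.zero_tmul]
    rw [h0, map_zero, map_zero, cell_of_degenerate, map_zero]
    rw [SSet.mem_degenerate_iff_notMem_nonDegenerate]
    exact fun hm => hxy (last_prismSimplex_mem pq.2 hm)

/-- The tensor product is free on its cells. -/
noncomputable def tensEquiv (X Y : SSet.{u}) (n : ℕ) : Tens X Y n ≃ₗ[ℤ] (TensCells X Y n →₀ ℤ) :=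
  (DFinsupp.mapRange.linearEquiv fun _ => finsuppTensorFinsupp' ℤ _ _).trans
    (sigmaFinsuppLequivDFinsupp ℤ).symm

lemma tensEquiv_tens (pq : {pq : ℕ × ℕ // pq.1 + pq.2 = n}) (x : X.nonDegenerate pq.1.1)
    (y : Y.nonDegenerate pq.1.2) :
    tensEquiv X Y n (tens pq x.1 y.1) = Finsupp.single ⟨pq, x, y⟩ 1 := by
  have h : finsuppTensorFinsupp' ℤ _ _ (cell X x.1 ⊗ₜ[ℤ] cell Y y.1) =
      Finsupp.single (x, y) 1 := by
    rw [cell_val, cell_val, finsuppTensorFinsupp'_single_tmul_single, mul_one]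
  refine (sigmaFinsuppLequivDFinsupp ℤ).symm_apply_eq.2
    (Eq.trans ?_ (sigmaFinsuppEquivDFinsupp_single _ _).symm)
  refine (DFinsupp.mapRange_single (hf := fun _ => map_zero _)).trans ?_
  exact congrArg _ h

lemma critOfTens_bijective (X Y : SSet.{u}) (n : ℕ) : Function.Bijective (critOfTens X Y n) := by
  -- In the bases of cells the map is a relabelling along the bijection `lastCell`.
  have h : critOfTens X Y n =
      Finsupp.lmapDomain ℤ ℤ (lastCell X Y n) ∘ₗ (tensEquiv X Y n).toLinearMap := by
    refine tens_ext fun pq x y => ?_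
    rw [LinearMap.comp_apply, LinearEquiv.coe_coe, tensEquiv_tens, critOfTens_tens,
      cell_of_mem (prismSimplex_mem x y (LPath.last_isInterior pq.2)), proj_single_of_pos,
      Finsupp.lmapDomain_apply, Finsupp.mapDomain_single]
    rfl
  have hl := lastCell_bijective X Y n
  have hm : Function.Bijective (Finsupp.lmapDomain ℤ ℤ (lastCell X Y n)) :=
    ⟨Finsupp.mapDomain_injective hl.1, Finsupp.mapDomain_surjective hl.2⟩
  rw [h]
  exact hm.comp (tensEquiv X Y n).bijective

/-- The path of a prism is untouched when `φ` and `ψ` act on its two factors, so last simplices go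
to last simplices, degenerate or not. This identifies `tensMap` with the map induced on critical
chains. -/
lemma critOfTens_tensMap (φ : X ⟶ X') (ψ : Y ⟶ Y') (n : ℕ) (z : Tens X Y n) :
    critOfTens X' Y' n (tensMap φ ψ n z) =
      (proj (CellComplex.IsCritical (ezField X' Y')) ∘ₗ normMap (φ ⊗ₘ ψ) n ∘ₗ
        incl (CellComplex.IsCritical (ezField X Y))) (critOfTens X Y n z) := by
  have h : critOfTens X' Y' n ∘ₗ tensMap φ ψ n =
      (proj (CellComplex.IsCritical (ezField X' Y')) ∘ₗ normMap (φ ⊗ₘ ψ) n ∘ₗ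
        incl (CellComplex.IsCritical (ezField X Y))) ∘ₗ critOfTens X Y n := ?_
  · exact LinearMap.congr_fun h z
  refine tens_ext fun pq x y => ?_
  have hm := prismSimplex_mem x y (LPath.last_isInterior pq.2)
  rw [LinearMap.comp_apply, LinearMap.comp_apply, LinearMap.comp_apply, LinearMap.comp_apply,
    tensMap_tens, critOfTens_tens, critOfTens_tens, cell_of_mem hm, proj_single_of_pos
      ((isCritical_iff (LPath.last_isInterior pq.2) rfl).2 (LPath.last_quiet pq.2)),
    incl_single, ← cell_of_mem hm, normMap_cell, tensorHom_prismSimplex]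

end EZ

theorem mainTheorem10 :
    -- the Eilenberg-Zilber vector field is an admissible discrete vector field whose critical
    -- chains are identified with the tensor product, and `(f, g, h)` is a reduction
    (∀ X Y : SSet.{u},
      EZ.CellComplex.IsVectorField (EZ.ezField X Y) ∧
      EZ.CellComplex.IsAdmissible (EZ.ezField X Y) ∧
      (∀ n, Function.Bijective (EZ.critOfTens X Y n)) ∧
      EZ.IsReduction (EZ.normD (X ⊗ Y)) (EZ.ezD X Y)
        (EZ.ezF X Y) (EZ.ezG X Y) (EZ.ezH X Y)) ∧
    -- simplicial maps induce a morphism of reductions, and are compatible with the vector fields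
    (∀ (X Y X' Y' : SSet.{u}) (φ : X ⟶ X') (ψ : Y ⟶ Y'),
      EZ.IsReductionMorphism
        (EZ.normD (X ⊗ Y)) (EZ.ezD X Y) (EZ.ezF X Y) (EZ.ezG X Y) (EZ.ezH X Y)
        (EZ.normD (X' ⊗ Y')) (EZ.ezD X' Y') (EZ.ezF X' Y') (EZ.ezG X' Y') (EZ.ezH X' Y')
        (EZ.normMap (φ ⊗ₘ ψ)) (EZ.tensMap φ ψ) ∧
      EZ.IsFieldCompatible φ ψ) ∧
    -- the induced morphism is natural: it respects identities and compositions
    (∀ (X Y : SSet.{u}) (n : ℕ),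
      EZ.normMap (𝟙 X ⊗ₘ 𝟙 Y) n = LinearMap.id ∧
      EZ.tensMap (𝟙 X) (𝟙 Y) n = LinearMap.id) ∧
    (∀ (X Y X' Y' X'' Y'' : SSet.{u}) (φ : X ⟶ X') (ψ : Y ⟶ Y') (φ' : X' ⟶ X'') (ψ' : Y' ⟶ Y'')
      (n : ℕ),
      EZ.normMap ((φ ≫ φ') ⊗ₘ (ψ ≫ ψ')) n =
        EZ.normMap (φ' ⊗ₘ ψ') n ∘ₗ EZ.normMap (φ ⊗ₘ ψ) n ∧
      EZ.tensMap (φ ≫ φ') (ψ ≫ ψ') n = EZ.tensMap φ' ψ' n ∘ₗ EZ.tensMap φ ψ n) := by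
  refine ⟨fun X Y => ⟨EZ.isVectorField_ezField X Y, (EZ.isRank_ezRank X Y).isAdmissible,
    EZ.critOfTens_bijective X Y, ?_⟩, fun X Y X' Y' φ ψ => ⟨?_, EZ.isFieldCompatible φ ψ⟩,
    fun X Y n => ⟨?_, EZ.tensMap_id X Y n⟩, fun X Y X' Y' X'' Y'' φ ψ φ' ψ' n =>
      ⟨?_, EZ.tensMap_comp φ ψ φ' ψ' n⟩⟩
  · exact (EZ.CellComplex.isReduction_w (EZ.isVectorField_ezField X Y)
      (EZ.bijective_dTargetSource X Y)).transport (EZ.critOfTens_bijective X Y)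
  · exact ((EZ.preserves_normMap φ ψ).isReductionMorphism (EZ.isVectorField_ezField X Y)
      (EZ.bijective_dTargetSource X Y) (EZ.isVectorField_ezField X' Y')
      (EZ.bijective_dTargetSource X' Y')).transport (EZ.critOfTens_bijective X Y)
      (EZ.critOfTens_bijective X' Y') (EZ.critOfTens_tensMap φ ψ)
  · rw [id_tensorHom_id, EZ.normMap_id]
  · rw [← tensorHom_comp_tensorHom, EZ.normMap_comp]
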